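/- Let $U=\{u_1,\dots,u_n\}$ be an ordered universe and $S\subseteq U$ an unknown set, $w=|S|$. An interval query specifies $i\le j$ and is answered by whether $S\cap\{u_i,\dots,u_j\}\neq\emptyset$. A (randomized) algorithm asks interval queries, one after the other, and may stop at any time and output a real number; it is non-adaptive if, for fixed coin tosses, the next query never depends on the answers received so far (the decision when to stop, and the output, may depend on them). It is a set size approximation algorithm for $\epsilon\in(0,1]$ if for every $S\subseteq U$ it outputs, with probability at least $2/3$ over its coin tosses, a number $\hat w$ with $\frac1{1+\epsilon}|S|\le\hat w\le(1+\epsilon)|S|$. Let $Q$ be the number of queries that it performs on $S$ (a random variable, $\infty$ if it does not stop). 1. (Non-adaptive upper bound.) There are non-adaptive set size approximation algorithms (one for every $n$ and every $\epsilon\in(0,1]$) such that for every $\delta>0$ there is a constant $C$ such that, for all $n$, $\epsilon$ and all non-empty $S$, $\Pr[Q\le C\,n/(w\epsilon^2)]\ge 1-\delta$, and $\Pr[Q> k\cdot C\,n/(w\epsilon^2)]\le e^{-k}$ for all real $k\ge1$. 2. (Non-adaptive lower bound.) There is a constant $p>0$ such that for every $\epsilon\in(0,1]$ there is $c>0$ such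 that for all $1\le w\le n$ and every non-adaptive set size approximation algorithm for $n$ and $\epsilon$ there is a set $S$ of size $w$ on which $\Pr[Q\ge c\,n/w]\ge p$. This holds even if the algorithm is given a constant factor approximation of the size: for every $\epsilon\in(0,1]$ and $\kappa\ge1$ there is $c>0$ such that, for all $n$, all real $\tilde w>0$ and every integer $w\le n$ with $\tilde w/\kappa\le w\le\kappa\tilde w$, every non-adaptive algorithm that is only required to be correct (with probability at least $2/3$) on the sets with $\tilde w/\kappa\le|S|\le\kappa\tilde w$ has a set $S$ of size $w$ on which $\Pr[Q\ge c\,n/w]\ge p$; here we exclude the case that $\tilde w$ alone already determines an answer, that is, that some single number $r$ satisfies $\frac{s}{1+\epsilon}\le r\le(1+\epsilon)s$ for all integers $s\le n$ with $\tilde w/\kappa\le s\le\kappa\tilde w$. 3. (Adaptive upper bound.) There are set size approximation algorithms (one for every $n$ and every $\epsilon\in(0,1]$) that, for some constant $C$, for all $n\ge2$, $\epsilon$, $S$ and all outcomes of the coin tosses, perform at most $C\max(w,1)\log n$ interval queries, and that moreover satisfy the two probability bounds of part 1 (for every $\delta>0$, with some constant depending only on $\delta$). 4. (Adaptive lower bound.)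 Both statements of part 2 hold for all (adaptive) algorithms, with $n/w$ replaced by $\min\{w\log(n/w^2),\,n/w\}$ if $w<\sqrt n$, and with $n/w$ unchanged if $w\ge\sqrt n$. -/

import Mathlib

open MeasureTheory
open scoped ENNReal

/-- The universe is `u_1 < ... < u_n`, represented by `Fin n`. An interval query is a nonempty
interval `{u_i, ..., u_j}`, given by its end points `i ≤ j`. -/
abbrev IntervalQuery (n : ℕ) : Type := NonemptyInterval (Fin n)

instance instMeasurableSpaceIntervalQuery (n : ℕ) : MeasurableSpace (IntervalQuery n) := ⊤

/-- The answer to the query `I` on the hidden set `S`: does the interval `I` intersect `S`? -/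
def IntervalQuery.answer {n : ℕ} (I : IntervalQuery n) (S : Finset (Fin n)) : Bool :=
  decide (∃ x ∈ S, I.fst ≤ x ∧ x ≤ I.snd)

/-- A deterministic (adaptive) algorithm using interval queries: given the answers received so
far, in chronological order, it either asks a further query (`Sum.inl`), or stops and outputs a
real number (`Sum.inr`). It is not required to stop. -/
abbrev Strategy (n : ℕ) : Type := List Bool → IntervalQuery n ⊕ ℝ

namespace Strategy

variable {n : ℕ}

/-- The answers received in the first `t` steps of the run on the hidden set `S` (after stopping,
nothing happens any more). -/
def transcript (σ : Strategy n) (S : Finset (Fin n)) : ℕ → List Bool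
  | 0 => []
  | t + 1 =>
    match σ (σ.transcript S t) with
    | Sum.inl I => σ.transcript S t ++ [I.answer S]
    | Sum.inr _ => σ.transcript S t

/-- The number of queries performed on `S`; it is `⊤` if the run never stops. -/
noncomputable def numQueries (σ : Strategy n) (S : Finset (Fin n)) : ℕ∞ :=
  ⨆ t : ℕ, ((σ.transcript S t).length : ℕ∞)

/-- The run on `S` stops and outputs `r`. -/
def Outputs (σ : Strategy n) (S : Finset (Fin n)) (r : ℝ) : Prop :=
  ∃ t : ℕ, σ (σ.transcript S t) = Sum.inr r

/-- The next query never depends on the answers received so far, only on how many queries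
have been made. The decision to stop, and the output, may depend on the answers. -/
def NonAdaptive (σ : Strategy n) : Prop :=
  ∀ (h h' : List Bool) (I I' : IntervalQuery n),
    h.length = h'.length → σ h = Sum.inl I → σ h' = Sum.inl I' → I = I'

end Strategy

/-- A randomized algorithm using interval queries: a probability space of coin tosses, and for
each outcome of the coin tosses a deterministic algorithm. (Taking `Coins : Type` loses nothing,
since only the law of `strategy` on the type `Strategy n : Type` matters.) -/
structure RandomizedAlgorithm (n : ℕ) where
  Coins : Type
  measurableSpace : MeasurableSpace Coins
  prob : Measure Coins
  isProbabilityMeasure : IsProbabilityMeasure prob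
  strategy : Coins → Strategy n
  measurable_strategy : ∀ h : List Bool, Measurable fun ω => strategy ω h

/-- `r` approximates the size `w` up to a factor of `1 + ε`. -/
def IsEstimate (ε : ℝ) (w : ℕ) (r : ℝ) : Prop :=
  1 / (1 + ε) * (w : ℝ) ≤ r ∧ r ≤ (1 + ε) * (w : ℝ)

namespace RandomizedAlgorithm

variable {n : ℕ}

/-- The probability of an event over the coin tosses of the algorithm. -/
noncomputable def Pr (A : RandomizedAlgorithm n) (E : Set A.Coins) : ℝ :=
  (@Measure.real A.Coins A.measurableSpace A.prob E)

/-- The number of queries performed on `S` when the coin tosses are `ω`, as an extended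
nonnegative real. -/
noncomputable def queries (A : RandomizedAlgorithm n) (S : Finset (Fin n)) (ω : A.Coins) : ℝ≥0∞ :=
  (((A.strategy ω).numQueries S : ℕ∞) : ℝ≥0∞)

/-- On every hidden set whose size is in `K`, the algorithm outputs with probability at least
`2/3` an estimate of that size up to a factor of `1 + ε`. -/
def ApproximatesOn (A : RandomizedAlgorithm n) (ε : ℝ) (K : Set ℕ) : Prop :=
  ∀ S : Finset (Fin n), S.card ∈ K →
    2 / 3 ≤ A.Pr {ω | ∃ r : ℝ, (A.strategy ω).Outputs S r ∧ IsEstimate ε S.card r}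

/-- A set size approximation algorithm, for the approximation parameter `ε`. -/
def IsSetSizeApproximation (A : RandomizedAlgorithm n) (ε : ℝ) : Prop :=
  A.ApproximatesOn ε Set.univ

def NonAdaptive (A : RandomizedAlgorithm n) : Prop :=
  ∀ ω : A.Coins, (A.strategy ω).NonAdaptive

end RandomizedAlgorithm

/-- The sizes `s` for which `v` is an approximation of `s` up to a factor of `κ`. -/
def admissibleSizes (κ v : ℝ) : Set ℕ := {s : ℕ | v / κ ≤ (s : ℝ) ∧ (s : ℝ) ≤ κ * v}

/-- Knowing `n` and an approximation `v` of the size up to a factor of `κ` already gives the answer: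
a single number is a correct estimate for all sizes that are still possible, so that no query
at all is needed. -/
def AdviceSuffices (n : ℕ) (ε κ v : ℝ) : Prop :=
  ∃ r : ℝ, ∀ s ∈ admissibleSizes κ v, s ≤ n → IsEstimate ε s r

/-- `min (w * log (n / w ^ 2)) (n / w)`; where the logarithm is not positive, that is for `w ≥ √n`,
the bound is `n / w`. -/
noncomputable def adaptiveBound (n w : ℕ) : ℝ :=
  if n ≤ w ^ 2 then (n : ℝ) / w
  else min ((w : ℝ) * Real.log ((n : ℝ) / (w : ℝ) ^ 2)) ((n : ℝ) / w)

/-- For the family `A` of algorithms (indexed by `n` and `ε`), the number of queries is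
`O(n / (w ε²))` with any desired constant probability below `1`, and the probability of exceeding
this bound by a factor of `k` decreases exponentially with `k`. -/
def QueriesBoundedWithExponentialTail (A : (n : ℕ) → (ε : ℝ) → RandomizedAlgorithm n) : Prop :=
  ∀ δ : ℝ, 0 < δ → ∃ C : ℝ, 0 < C ∧
    ∀ (n : ℕ) (ε : ℝ), 0 < ε → ε ≤ 1 → ∀ S : Finset (Fin n), S.Nonempty →
      1 - δ ≤ (A n ε).Pr {ω | (A n ε).queries S ω ≤
        ENNReal.ofReal (C * (n / (S.card * ε ^ 2)))} ∧
      ∀ k : ℝ, 1 ≤ k →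
        (A n ε).Pr {ω | ENNReal.ofReal (k * (C * (n / (S.card * ε ^ 2)))) <
          (A n ε).queries S ω} ≤ Real.exp (-k)

/-- Every algorithm satisfying `Q` that approximates set sizes performs `Ω(g n w)` interval
queries with probability at least `p`: for all `1 ≤ w ≤ n` there is a set of size `w` on which it
does. This remains true if the algorithm is given an approximation `v` of the size of the set up
to a constant factor `κ`, so that it need only be correct on the sets whose size is within a factor
of `κ` from `v` (unless knowing `v` makes queries superfluous). -/
def QueryLowerBound (Q : ∀ n : ℕ, RandomizedAlgorithm n → Prop) (g : ℕ → ℕ → ℝ) (p : ℝ) : Prop :=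
  (∀ ε : ℝ, 0 < ε → ε ≤ 1 → ∃ c : ℝ, 0 < c ∧
    ∀ n w : ℕ, 1 ≤ w → w ≤ n →
      ∀ A : RandomizedAlgorithm n, Q n A → A.IsSetSizeApproximation ε →
        ∃ S : Finset (Fin n), S.card = w ∧
          p ≤ A.Pr {ω | ENNReal.ofReal (c * g n w) ≤ A.queries S ω}) ∧
  (∀ ε : ℝ, 0 < ε → ε ≤ 1 → ∀ κ : ℝ, 1 ≤ κ → ∃ c : ℝ, 0 < c ∧
    ∀ (n w : ℕ) (v : ℝ), 0 < v → w ≤ n → w ∈ admissibleSizes κ v → ¬ AdviceSuffices n ε κ v →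
      ∀ A : RandomizedAlgorithm n, Q n A → A.ApproximatesOn ε (admissibleSizes κ v) →
        ∃ S : Finset (Fin n), S.card = w ∧
          p ≤ A.Pr {ω | ENNReal.ofReal (c * g n w) ≤ A.queries S ω})

/-!
Both upper bounds come from one construction. Let `T` be a finite decision tree that determines the
size of the hidden set exactly. Race `T` against random sampling: alternate the queries of `T` with
queries for independent uniform elements, and stop when `T` stops or when `m ≈ 64 / ε²` samples have
been found in the set, in which case `m * n / t` is returned for the number `t` of samples. Chernoff
bounds for the number of hits show that the estimate is good with probability at least `2/3`
(`real_few_hits_le`, `real_many_hits_le`) and that taking `k` times longer than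
`O(n / (w ε²))` has probability at most `exp (-k)` (`real_few_hits_le_exp`). This holds whatever `T`
is. If `T` queries all elements one by one, the race is non-adaptive; if `T` is a dyadic search,
which asks `O(w log n)` queries, then the race never takes more than twice as long.

For the lower bounds, divide the universe into `k` blocks of `m` cells. The base set contains the
first element of one cell `y i` in every block `i` (and some fixed elements at the end); a further
set contains in addition some elements that follow the base element of one block `i`. A query tells
the two apart only if its left end lies in that cell (`fst_div_eq_of_answer_ne`), since otherwise a
hit among the extra elements comes with a hit of the base element. So an algorithm that has to
separate two sizes has to guess the cell `y i` of a random block `i` for a random `y`, and it must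
do so even on the sets of an intermediate size `w`, because runs that stop earlier have the same
output on the sets of all three sizes (`exists_quarter_le_Pr_queries`). It remains to count how many pairs
`(y, i)` are found with `t` queries:

* a non-adaptive algorithm finds at most `t` of the `m ≈ n / w` cells of a single block;
* if every block is a single cell, at most `t` of the `k` blocks are found, and `k ≈ n / w` is
  possible if `n = O(w²)`;
* otherwise take `k ≈ w` and `m ≈ n / w²`. For fixed guesses the number `F` of blocks found
  satisfies `E[m ^ F] ≤ exp t`, as the `y i` are independent, and a decision tree with `t`
  queries has at most `2 ^ t` leaves, so that `E[m ^ F] ≤ exp (2 * t)` and `E[F] ≤ 2 * t / log m`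
  (`card_foundPairs_mul_log_le`).
-/

/-! ### Decision trees -/

/-- The query that asks whether the single element `x` belongs to the hidden set. -/
def IntervalQuery.single {n : ℕ} (x : Fin n) : IntervalQuery n := ⟨(x, x), le_rfl⟩

theorem IntervalQuery.answer_single {n : ℕ} (x : Fin n) (S : Finset (Fin n)) :
    (IntervalQuery.single x).answer S = decide (x ∈ S) := by
  unfold IntervalQuery.answer IntervalQuery.single
  congr 1
  apply propext
  constructor
  · rintro ⟨y, hy, h1, h2⟩
    rwa [show x = y from le_antisymm h1 h2]
  · intro h
    exact ⟨x, h, le_rfl, le_rfl⟩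

/-- A finite decision tree: a leaf stops with an output, an inner node asks a query and continues
with the first subtree after a negative answer and with the second one after a positive answer. -/
inductive QueryTree (n : ℕ) : Type
  | leaf (r : ℝ) : QueryTree n
  | node (I : IntervalQuery n) (no yes : QueryTree n) : QueryTree n

namespace QueryTree

variable {n : ℕ}

/-- The strategy that walks down the tree. Its value on histories that do not occur is
irrelevant. -/
def toStrategy : QueryTree n → Strategy n
  | leaf r, _ => Sum.inr r
  | node I _ _, [] => Sum.inl I
  | node _ f g, b :: h => (if b then g else f).toStrategy h

/-- The output of the tree on the hidden set `S`. -/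
def value (S : Finset (Fin n)) : QueryTree n → ℝ
  | leaf r => r
  | node I f g => if I.answer S then g.value S else f.value S

/-- The number of queries on the path of the hidden set `S`. -/
def cost (S : Finset (Fin n)) : QueryTree n → ℕ
  | leaf _ => 0
  | node I f g => 1 + if I.answer S then g.cost S else f.cost S

end QueryTree

namespace Strategy

variable {n : ℕ}

theorem transcript_succ_inl {σ : Strategy n} {S : Finset (Fin n)} {t : ℕ} {I : IntervalQuery n}
    (h : σ (σ.transcript S t) = Sum.inl I) :
    σ.transcript S (t + 1) = σ.transcript S t ++ [I.answer S] := by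
  simp only [transcript, h]

theorem transcript_succ_inr {σ : Strategy n} {S : Finset (Fin n)} {t : ℕ} {r : ℝ}
    (h : σ (σ.transcript S t) = Sum.inr r) :
    σ.transcript S (t + 1) = σ.transcript S t := by
  simp only [transcript, h]

theorem transcript_eq_of_stopped {σ : Strategy n} {S : Finset (Fin n)} {t : ℕ} {r : ℝ}
    (h : σ (σ.transcript S t) = Sum.inr r) {u : ℕ} (hu : t ≤ u) :
    σ.transcript S u = σ.transcript S t := by
  induction u, hu using Nat.le_induction with
  | base => rfl
  | succ u _ ih => rw [transcript_succ_inr (r := r) (by rw [ih, h]), ih]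

theorem length_transcript_le (σ : Strategy n) (S : Finset (Fin n)) (t : ℕ) :
    (σ.transcript S t).length ≤ t := by
  induction t with
  | zero => simp [transcript]
  | succ t ih =>
    cases h : σ (σ.transcript S t) with
    | inl I => rw [transcript_succ_inl h]; simpa using ih
    | inr r => rw [transcript_succ_inr h]; omega

theorem Outputs.unique {σ : Strategy n} {S : Finset (Fin n)} {r r' : ℝ}
    (h : σ.Outputs S r) (h' : σ.Outputs S r') : r = r' := by
  obtain ⟨t, ht⟩ := h
  obtain ⟨t', ht'⟩ := h'
  rcases le_total t t' with hle | hle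
  · rw [transcript_eq_of_stopped ht hle, ht] at ht'
    exact Sum.inr.inj ht'
  · rw [transcript_eq_of_stopped ht' hle, ht'] at ht
    exact (Sum.inr.inj ht).symm

/-- After the first query the run continues as the run of the strategy that has already received
the first answer. -/
theorem transcript_succ_eq_cons {σ : Strategy n} {S : Finset (Fin n)} {I : IntervalQuery n}
    (h : σ [] = Sum.inl I) (t : ℕ) :
    σ.transcript S (t + 1) =
      I.answer S :: Strategy.transcript (fun l => σ (I.answer S :: l)) S t := by
  induction t with
  | zero => simp [transcript, h]
  | succ t ih =>
    cases h' : σ (σ.transcript S (t + 1)) with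
    | inl J =>
      rw [transcript_succ_inl h', ih,
        transcript_succ_inl (σ := fun l => σ (I.answer S :: l)) (I := J) (by rw [← h', ih]),
        List.cons_append]
    | inr r =>
      rw [transcript_succ_inr h', ih,
        transcript_succ_inr (σ := fun l => σ (I.answer S :: l)) (r := r) (by rw [← h', ih])]

end Strategy

namespace QueryTree

variable {n : ℕ}

theorem transcript_node (S : Finset (Fin n)) (I : IntervalQuery n) (f g : QueryTree n) (t : ℕ) :
    (node I f g).toStrategy.transcript S (t + 1) =
      I.answer S :: (if I.answer S then g else f).toStrategy.transcript S t := by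
  rw [Strategy.transcript_succ_eq_cons (I := I) (by simp [toStrategy])]
  rfl

theorem length_transcript_le_cost (S : Finset (Fin n)) (T : QueryTree n) (t : ℕ) :
    (T.toStrategy.transcript S t).length ≤ T.cost S := by
  induction T generalizing t with
  | leaf r =>
    rw [Strategy.transcript_eq_of_stopped (t := 0) (r := r) (by simp [toStrategy]) (Nat.zero_le t)]
    simp [Strategy.transcript]
  | node I f g hf hg =>
    cases t with
    | zero => simp [Strategy.transcript]
    | succ t =>
      rw [transcript_node, List.length_cons, cost]
      split_ifs with h
      · have := hg t; omega
      · have := hf t; omega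

theorem numQueries_le_cost (S : Finset (Fin n)) (T : QueryTree n) :
    T.toStrategy.numQueries S ≤ T.cost S :=
  iSup_le fun t => by exact_mod_cast length_transcript_le_cost S T t

theorem outputs_value (S : Finset (Fin n)) (T : QueryTree n) :
    T.toStrategy.Outputs S (T.value S) := by
  induction T with
  | leaf r => exact ⟨0, by simp [toStrategy, value]⟩
  | node I f g hf hg =>
    have key : ∃ t, (if I.answer S then g else f).toStrategy
        ((if I.answer S then g else f).toStrategy.transcript S t) =
          Sum.inr ((node I f g).value S) := by
      rw [value]
      split_ifs
      · exact hg
      · exact hf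
    obtain ⟨t, ht⟩ := key
    exact ⟨t + 1, by rw [transcript_node]; exact ht⟩

/-! ### Two trees that determine the size exactly -/

/-- Asks for the elements of the list one by one; `c` is the number of elements found before. -/
def scan : List (Fin n) → ℕ → QueryTree n
  | [], c => leaf c
  | x :: l, c => node (IntervalQuery.single x) (scan l c) (scan l (c + 1))

theorem value_scan (S : Finset (Fin n)) (l : List (Fin n)) (c : ℕ) :
    (scan l c).value S = ((c + (l.filter (· ∈ S)).length : ℕ) : ℝ) := by
  induction l generalizing c with
  | nil => simp [scan, value]
  | cons x l ih =>
    rw [scan, value, IntervalQuery.answer_single, ih, ih]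
    by_cases h : x ∈ S
    · simp only [h, decide_true, if_true, List.filter_cons_of_pos, List.length_cons]
      congr 1; omega
    · simp [h]

theorem value_scan_finRange (S : Finset (Fin n)) :
    (scan (List.finRange n) 0).value S = S.card := by
  rw [value_scan, zero_add]
  congr 1
  have h1 : ((List.finRange n).filter (· ∈ S)).Nodup := (List.nodup_finRange n).filter _
  rw [← List.toFinset_card_of_nodup h1]
  congr 1
  ext x
  simp

/-- Dyadic search: counts the hidden elements in the window of `2 ^ d` positions from `lo` on and
continues with `k` of that number. A window is split only if it is hit. -/
def search (d lo : ℕ) (k : ℕ → QueryTree n) : QueryTree n :=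
  if h : lo < n then
    node ⟨(⟨lo, h⟩, ⟨min (lo + 2 ^ d - 1) (n - 1), by omega⟩), by
        have := Nat.one_le_two_pow (n := d)
        simp only [Fin.mk_le_mk]
        omega⟩
      (k 0)
      (match d with
        | 0 => k 1
        | d + 1 => search d lo fun a => search d (lo + 2 ^ d) fun b => k (a + b))
  else k 0

/-- The number of hidden elements in the window of length `len` from position `lo` on. -/
def windowCount (S : Finset (Fin n)) (lo len : ℕ) : ℕ :=
  (S.filter fun x => lo ≤ x.val ∧ x.val < lo + len).card

theorem windowCount_add (S : Finset (Fin n)) (lo len len' : ℕ) :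
    windowCount S lo (len + len') = windowCount S lo len + windowCount S (lo + len) len' := by
  unfold windowCount
  rw [← Finset.card_union_of_disjoint]
  · congr 1
    ext x
    simp only [Finset.mem_filter, Finset.mem_union]
    constructor
    · rintro ⟨h, h1, h2⟩
      by_cases h3 : x.val < lo + len
      · exact Or.inl ⟨h, h1, h3⟩
      · exact Or.inr ⟨h, by omega, by omega⟩
    · rintro (⟨h, h1, h2⟩ | ⟨h, h1, h2⟩)
      · exact ⟨h, h1, by omega⟩
      · exact ⟨h, by omega, by omega⟩
  · rw [Finset.disjoint_filter]
    intro x _ h1 h2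
    omega

theorem windowCount_eq_zero_of_le (S : Finset (Fin n)) {lo len : ℕ} (h : n ≤ lo) :
    windowCount S lo len = 0 := by
  unfold windowCount
  rw [Finset.card_eq_zero, Finset.filter_eq_empty_iff]
  intro x _ hx
  have := x.isLt
  omega

theorem windowCount_one_le (S : Finset (Fin n)) (lo : ℕ) : windowCount S lo 1 ≤ 1 := by
  unfold windowCount
  rw [Finset.card_le_one]
  intro x hx y hy
  simp only [Finset.mem_filter] at hx hy
  apply Fin.ext
  omega

theorem answer_window (S : Finset (Fin n)) {d lo : ℕ} (I : IntervalQuery n)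
    (h1 : I.fst.val = lo) (h2 : I.snd.val = min (lo + 2 ^ d - 1) (n - 1)) :
    I.answer S = decide (0 < windowCount S lo (2 ^ d)) := by
  unfold IntervalQuery.answer windowCount
  congr 1
  apply propext
  rw [Finset.card_pos]
  constructor
  · rintro ⟨x, hx, ha, hb⟩
    refine ⟨x, Finset.mem_filter.2 ⟨hx, ?_⟩⟩
    rw [Fin.le_def] at ha hb
    have := Nat.one_le_two_pow (n := d)
    omega
  · rintro ⟨x, hx⟩
    rw [Finset.mem_filter] at hx
    have := x.isLt
    refine ⟨x, hx.1, ?_, ?_⟩ <;> rw [Fin.le_def] <;> omega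

theorem value_search (S : Finset (Fin n)) (d lo : ℕ) (k : ℕ → QueryTree n) :
    (search d lo k).value S = (k (windowCount S lo (2 ^ d))).value S := by
  induction d generalizing lo k with
  | zero =>
    unfold search
    split_ifs with h
    · rw [value, answer_window S (d := 0) (lo := lo) _ rfl rfl]
      have := windowCount_one_le S lo
      rw [pow_zero]
      rcases Nat.eq_zero_or_pos (windowCount S lo 1) with h0 | h0
      · simp [h0]
      · have h1 : windowCount S lo 1 = 1 := by omega
        simp [h1]
    · rw [windowCount_eq_zero_of_le S (by omega)]
  | succ d ih =>
    unfold search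
    split_ifs with h
    · rw [value, answer_window S (d := d + 1) (lo := lo) _ rfl rfl]
      rcases Nat.eq_zero_or_pos (windowCount S lo (2 ^ (d + 1))) with h0 | h0
      · simp [h0]
      · simp only [h0, decide_true, if_true]
        rw [ih, ih, pow_succ, mul_two, windowCount_add]
    · rw [windowCount_eq_zero_of_le S (by omega)]

/-- Each hidden element is responsible for at most two queries per level: a window that is hit
accounts for its two halves. -/
theorem cost_search_le (S : Finset (Fin n)) (d lo : ℕ) (k : ℕ → QueryTree n) :
    (search d lo k).cost S ≤ 1 + 2 * (d * windowCount S lo (2 ^ d)) +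
      (k (windowCount S lo (2 ^ d))).cost S := by
  induction d generalizing lo k with
  | zero =>
    unfold search
    split_ifs with h
    · rw [cost, answer_window S (d := 0) (lo := lo) _ rfl rfl]
      have := windowCount_one_le S lo
      rw [pow_zero]
      rcases Nat.eq_zero_or_pos (windowCount S lo 1) with h0 | h0
      · simp [h0]
      · have h1 : windowCount S lo 1 = 1 := by omega
        simp [h1]
    · rw [windowCount_eq_zero_of_le S (by omega)]
      omega
  | succ d ih =>
    unfold search
    split_ifs with h
    · rw [cost, answer_window S (d := d + 1) (lo := lo) _ rfl rfl]
      rcases Nat.eq_zero_or_pos (windowCount S lo (2 ^ (d + 1))) with h0 | h0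
      · simp [h0]
      · simp only [h0, decide_true, if_true]
        have h1 := ih lo fun a => search d (lo + 2 ^ d) fun b => k (a + b)
        have h2 := ih (lo + 2 ^ d) fun b => k (windowCount S lo (2 ^ d) + b)
        rw [pow_succ, mul_two, windowCount_add] at h0 ⊢
        set a := windowCount S lo (2 ^ d)
        set b := windowCount S (lo + 2 ^ d) (2 ^ d)
        have h3 : (d + 1) * (a + b) = d * a + d * b + (a + b) := by ring
        rw [h3]
        omega
    · rw [windowCount_eq_zero_of_le S (by omega)]
      omega

/-- The dyadic search in the whole universe, with the size as output. -/
def searchAll (n : ℕ) : QueryTree n := search (Nat.clog 2 n) 0 fun c => leaf c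

theorem windowCount_clog (S : Finset (Fin n)) : windowCount S 0 (2 ^ Nat.clog 2 n) = S.card := by
  unfold windowCount
  congr 1
  rw [Finset.filter_eq_self]
  intro x _
  have := Nat.le_pow_clog (b := 2) (by norm_num) n
  have := x.isLt
  omega

theorem value_searchAll (S : Finset (Fin n)) : (searchAll n).value S = S.card := by
  rw [searchAll, value_search, windowCount_clog, value]

theorem cost_searchAll_le (S : Finset (Fin n)) :
    (searchAll n).cost S ≤ 1 + 2 * (Nat.clog 2 n * S.card) := by
  have := cost_search_le S (Nat.clog 2 n) 0 fun c => leaf c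
  rwa [windowCount_clog, cost] at this

/-! ### Racing a tree against random sampling -/

/-- Alternates between the queries of a given tree and queries for the sampled elements
`x j, x (j + 1), …`, where `c` counts the samples found in the hidden set. If the tree stops, its
output is returned; once `m` samples have been found, among `j` in total, the output is
`m * n / j`. -/
noncomputable def race (m : ℕ) (x : ℕ → Fin n) : QueryTree n → ℕ → ℕ → QueryTree n
  | leaf r, _, _ => leaf r
  | node I f g, j, c =>
    if m ≤ c then leaf ((m : ℝ) * n / j)
    else node I
      (node (IntervalQuery.single (x j)) (race m x f (j + 1) c) (race m x f (j + 1) (c + 1)))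
      (node (IntervalQuery.single (x j)) (race m x g (j + 1) c) (race m x g (j + 1) (c + 1)))

/-- The number of the first `t` samples that lie in `S`. -/
def hits (S : Finset (Fin n)) (x : ℕ → Fin n) (t : ℕ) : ℕ :=
  ((Finset.range t).filter fun i => x i ∈ S).card

theorem hits_succ (S : Finset (Fin n)) (x : ℕ → Fin n) (t : ℕ) :
    hits S x (t + 1) = hits S x t + if x t ∈ S then 1 else 0 := by
  unfold hits
  rw [Finset.range_add_one, Finset.filter_insert]
  split_ifs with h
  · rw [Finset.card_insert_of_notMem (by simp)]
  · rfl

theorem hits_mono (S : Finset (Fin n)) (x : ℕ → Fin n) : Monotone (hits S x) :=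
  monotone_nat_of_le_succ fun t => by rw [hits_succ]; omega

theorem value_race_node (S : Finset (Fin n)) {m j : ℕ} (x : ℕ → Fin n) (I : IntervalQuery n)
    (f g : QueryTree n) (h : hits S x j < m) :
    (race m x (node I f g) j (hits S x j)).value S =
      (race m x (if I.answer S then g else f) (j + 1) (hits S x (j + 1))).value S := by
  rw [race, if_neg (by omega), value, hits_succ]
  by_cases h1 : I.answer S <;> by_cases h2 : x j ∈ S <;>
    simp [h1, h2, value, IntervalQuery.answer_single]

theorem cost_race_node (S : Finset (Fin n)) {m j : ℕ} (x : ℕ → Fin n) (I : IntervalQuery n)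
    (f g : QueryTree n) (h : hits S x j < m) :
    (race m x (node I f g) j (hits S x j)).cost S =
      2 + (race m x (if I.answer S then g else f) (j + 1) (hits S x (j + 1))).cost S := by
  rw [race, if_neg (by omega), cost, hits_succ]
  by_cases h1 : I.answer S <;> by_cases h2 : x j ∈ S <;>
    simp [h1, h2, cost, IntervalQuery.answer_single] <;> omega

/-- The race returns the output of the tree or the estimate of the sampling process. -/
theorem value_race (S : Finset (Fin n)) {m : ℕ} (x : ℕ → Fin n) (T : QueryTree n) {j : ℕ}
    (hj : hits S x j ≤ m) :
    (race m x T j (hits S x j)).value S = T.value S ∨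
      ∃ t, hits S x t = m ∧ (race m x T j (hits S x j)).value S = (m : ℝ) * n / t := by
  induction T generalizing j with
  | leaf r => exact Or.inl rfl
  | node I f g hf hg =>
    rcases hj.eq_or_lt with h | h
    · refine Or.inr ⟨j, h, ?_⟩
      rw [race, if_pos h.ge, value]
    · rw [value_race_node S x I f g h, value]
      have h' : hits S x (j + 1) ≤ m := by rw [hits_succ]; split_ifs <;> omega
      split_ifs
      · exact hg h'
      · exact hf h'

theorem cost_race_le_two_mul (S : Finset (Fin n)) {m : ℕ} (x : ℕ → Fin n) (T : QueryTree n)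
    (j : ℕ) : (race m x T j (hits S x j)).cost S ≤ 2 * T.cost S := by
  induction T generalizing j with
  | leaf r => simp [race, cost]
  | node I f g hf hg =>
    rcases lt_or_ge (hits S x j) m with h | h
    · rw [cost_race_node S x I f g h, cost]
      split_ifs
      · have := hg (j + 1); omega
      · have := hf (j + 1); omega
    · rw [race, if_pos h, cost]
      omega

theorem cost_race_le_of_hits (S : Finset (Fin n)) {m t : ℕ} (x : ℕ → Fin n) (T : QueryTree n)
    (ht : m ≤ hits S x t) (j : ℕ) (hjt : j ≤ t) :
    (race m x T j (hits S x j)).cost S + 2 * j ≤ 2 * t := by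
  induction T generalizing j with
  | leaf r => simp only [race, cost]; omega
  | node I f g hf hg =>
    rcases lt_or_ge (hits S x j) m with h | h
    · have hlt : j < t := by
        by_contra hcon
        have := hits_mono S x (not_lt.1 hcon)
        omega
      rw [cost_race_node S x I f g h]
      split_ifs
      · have := hg (j + 1) hlt; omega
      · have := hf (j + 1) hlt; omega
    · rw [race, if_pos h, cost]
      omega

/-- Racing a scan gives a non-adaptive strategy. -/
theorem nonAdaptive_race_scan (m : ℕ) (x : ℕ → Fin n) (l : List (Fin n)) (j c₁ c₁' c₂ c₂' : ℕ)
    (h h' : List Bool) (I I' : IntervalQuery n) (hlen : h.length = h'.length)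
    (hI : (race m x (scan l c₁) j c₁').toStrategy h = Sum.inl I)
    (hI' : (race m x (scan l c₂) j c₂').toStrategy h' = Sum.inl I') : I = I' := by
  induction l generalizing j c₁ c₁' c₂ c₂' h h' with
  | nil => simp [scan, race, toStrategy] at hI
  | cons y l ih =>
    rw [scan, race] at hI hI'
    split_ifs at hI
    · simp [toStrategy] at hI
    split_ifs at hI'
    · simp [toStrategy] at hI'
    match h, h', hlen with
    | [], [], _ =>
      simp only [toStrategy, Sum.inl.injEq] at hI hI'
      exact hI.symm.trans hI'
    | [b], [b'], _ =>
      cases b <;> cases b' <;> simp [toStrategy] at hI hI' <;> exact hI.symm.trans hI'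
    | b₁ :: b₂ :: h, b₁' :: b₂' :: h', hlen =>
      have hlen' : h.length = h'.length := by simpa using hlen
      cases b₁ <;> cases b₂ <;> cases b₁' <;> cases b₂' <;>
        simp only [toStrategy, if_true, Bool.false_eq_true, if_false] at hI hI' <;>
        exact ih _ _ _ _ _ _ _ hlen' hI hI'

end QueryTree

/-! ### The sampling process -/

/-- The law of a sequence of independent uniform samples from a universe of size `n + 1`. -/
noncomputable def sampleMeasure (n : ℕ) : Measure (ℕ → Fin (n + 1)) :=
  Measure.infinitePi fun _ => (PMF.uniformOfFintype (Fin (n + 1))).toMeasure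

namespace sampleMeasure

open QueryTree ProbabilityTheory

variable {n : ℕ}

instance instIsProbabilityMeasure : IsProbabilityMeasure (sampleMeasure n) := by
  unfold sampleMeasure; infer_instance

/-- The indicator of the event that the `i`-th sample lies in `S`. -/
noncomputable def hit (S : Finset (Fin (n + 1))) (i : ℕ) (x : ℕ → Fin (n + 1)) : ℝ :=
  if x i ∈ S then 1 else 0

theorem measurable_hit (S : Finset (Fin (n + 1))) (i : ℕ) : Measurable (hit S i) :=
  (Measurable.of_discrete (f := fun y : Fin (n + 1) => if y ∈ S then (1 : ℝ) else 0)).comp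
    (measurable_pi_apply i)

theorem sum_hit (S : Finset (Fin (n + 1))) (t : ℕ) (x : ℕ → Fin (n + 1)) :
    (∑ i ∈ Finset.range t, hit S i) x = hits S x t := by
  simp [hit, hits, Finset.sum_apply]

theorem measurable_hits (S : Finset (Fin (n + 1))) (t : ℕ) :
    Measurable fun x => (hits S x t : ℝ) := by
  simp_rw [← sum_hit, Finset.sum_apply]
  exact Finset.measurable_fun_sum _ fun i _ => measurable_hit S i

theorem mgf_hit (S : Finset (Fin (n + 1))) (i : ℕ) (l : ℝ) :
    mgf (hit S i) (sampleMeasure n) l =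
      1 + (S.card : ℝ) / ((n + 1 : ℕ) : ℝ) * (Real.exp l - 1) := by
  have hN : ((n : ℝ) + 1) ≠ 0 := by positivity
  have h1 : mgf (hit S i) (sampleMeasure n) l =
      ∫ y, Real.exp (l * if y ∈ S then (1 : ℝ) else 0)
        ∂(PMF.uniformOfFintype (Fin (n + 1))).toMeasure := by
    rw [mgf, ← (measurePreserving_eval_infinitePi
      (fun _ : ℕ => (PMF.uniformOfFintype (Fin (n + 1))).toMeasure) i).map_eq,
      integral_map (measurable_pi_apply i).aemeasurable
        (Measurable.of_discrete.aestronglyMeasurable)]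
    rfl
  have h2 : ∀ y : Fin (n + 1), Real.exp (l * if y ∈ S then (1 : ℝ) else 0) =
      1 + if y ∈ S then Real.exp l - 1 else 0 := by
    intro y
    split_ifs <;> simp
  rw [h1, PMF.integral_eq_sum]
  simp only [h2, PMF.uniformOfFintype_apply, smul_eq_mul, ← Finset.mul_sum,
    Finset.sum_add_distrib, Finset.sum_ite_mem, Finset.univ_inter, Finset.sum_const, nsmul_eq_mul,
    Finset.card_univ, Fintype.card_fin, ENNReal.toReal_inv, ENNReal.toReal_natCast]
  push_cast
  field_simp

theorem integrable_exp_hits (S : Finset (Fin (n + 1))) (t : ℕ) (l : ℝ) :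
    Integrable (fun x => Real.exp (l * (hits S x t : ℝ))) (sampleMeasure n) := by
  refine Integrable.of_bound (C := Real.exp (|l| * t))
    ((measurable_hits S t).const_mul l).exp.aestronglyMeasurable (Filter.Eventually.of_forall ?_)
  intro x
  rw [Real.norm_eq_abs, Real.abs_exp, Real.exp_le_exp]
  have h : (hits S x t : ℝ) ≤ t := by
    unfold hits
    exact_mod_cast (Finset.card_filter_le _ _).trans (by simp)
  exact mul_le_mul (le_abs_self l) h (by positivity) (abs_nonneg l)

theorem mgf_hits_le (S : Finset (Fin (n + 1))) (t : ℕ) (l : ℝ) :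
    mgf (fun x => (hits S x t : ℝ)) (sampleMeasure n) l ≤
      Real.exp ((S.card : ℝ) / ((n + 1 : ℕ) : ℝ) * t * (Real.exp l - 1)) := by
  have hind : iIndepFun (fun i => hit S i) (sampleMeasure n) :=
    iIndepFun_infinitePi
      (P := fun _ : ℕ => (PMF.uniformOfFintype (Fin (n + 1))).toMeasure)
      (X := fun _ y => if y ∈ S then (1 : ℝ) else 0) fun _ => Measurable.of_discrete
  have h1 : (fun x => (hits S x t : ℝ)) = ∑ i ∈ Finset.range t, hit S i :=
    funext fun x => (sum_hit S t x).symm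
  rw [h1, hind.mgf_sum (measurable_hit S)]
  simp only [mgf_hit, Finset.prod_const, Finset.card_range]
  set p := (S.card : ℝ) / ((n + 1 : ℕ) : ℝ)
  have hp1 : p ≤ 1 := by
    refine div_le_one_of_le₀ ?_ (by positivity)
    exact_mod_cast (Finset.card_le_univ S).trans (by simp)
  have hp0 : 0 ≤ p := by positivity
  have h3 : 0 ≤ 1 + p * (Real.exp l - 1) := by nlinarith [Real.exp_pos l]
  calc (1 + p * (Real.exp l - 1)) ^ t ≤ Real.exp (p * (Real.exp l - 1)) ^ t := by
        gcongr
        linarith [Real.add_one_le_exp (p * (Real.exp l - 1))]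
    _ = _ := by rw [← Real.exp_nat_mul]; congr 1; ring

/-- Chernoff bound for the upper tail of the number of hits. -/
theorem real_hits_ge_le (S : Finset (Fin (n + 1))) (t m : ℕ) {l : ℝ} (hl : 0 ≤ l) :
    (sampleMeasure n).real {x | m ≤ hits S x t} ≤
      Real.exp ((S.card : ℝ) / ((n + 1 : ℕ) : ℝ) * t * (Real.exp l - 1) - l * m) := by
  have h := measure_ge_le_exp_mul_mgf (m : ℝ) hl (integrable_exp_hits S t l)
  simp only [Nat.cast_le] at h
  refine h.trans ?_
  rw [sub_eq_neg_add, Real.exp_add, neg_mul]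
  gcongr
  exact mgf_hits_le S t l

/-- Chernoff bound for the lower tail of the number of hits. -/
theorem real_hits_le_le (S : Finset (Fin (n + 1))) (t m : ℕ) {l : ℝ} (hl : 0 ≤ l) :
    (sampleMeasure n).real {x | hits S x t ≤ m} ≤
      Real.exp ((S.card : ℝ) / ((n + 1 : ℕ) : ℝ) * t * (Real.exp (-l) - 1) + l * m) := by
  have h := measure_le_le_exp_mul_mgf (m : ℝ) (neg_nonpos.2 hl) (integrable_exp_hits S t (-l))
  simp only [Nat.cast_le] at h
  refine h.trans ?_
  rw [add_comm (_ * _) (l * (m : ℝ)), Real.exp_add, neg_neg]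
  gcongr
  exact mgf_hits_le S t (-l)

end sampleMeasure

/-! ### The upper bounds -/

section UpperBounds

open QueryTree

/-- The number of hits after which the sampling process stops. -/
noncomputable def hitTarget (ε : ℝ) : ℕ := ⌈64 / ε ^ 2⌉₊

theorem measurable_race {n : ℕ} (m : ℕ) (T : QueryTree (n + 1)) (j c : ℕ) (h : List Bool) :
    Measurable fun x : ℕ → Fin (n + 1) => (race m x T j c).toStrategy h := by
  induction T generalizing j c h with
  | leaf r =>
    simp only [race]
    exact measurable_const
  | node I f g hf hg =>
    simp only [race]
    split_ifs
    · exact measurable_const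
    match h with
    | [] => exact measurable_const
    | [b] =>
      have hm : Measurable fun x : ℕ → Fin (n + 1) =>
          (Sum.inl (IntervalQuery.single (x j)) : IntervalQuery (n + 1) ⊕ ℝ) :=
        measurable_inl.comp
          ((Measurable.of_discrete (f := fun y : Fin (n + 1) => IntervalQuery.single y)).comp
            (measurable_pi_apply j))
      cases b <;> exact hm
    | b₁ :: b₂ :: h =>
      cases b₁ <;> cases b₂ <;> simp only [toStrategy, if_true, Bool.false_eq_true, if_false]
      · exact hf _ _ _
      · exact hf _ _ _
      · exact hg _ _ _
      · exact hg _ _ _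

/-- The race of random sampling against the given trees. In the empty universe, where nothing can
be sampled, the tree is followed alone. -/
noncomputable def raceAlgorithm (T : ∀ n, QueryTree n) : (n : ℕ) → ℝ → RandomizedAlgorithm n
  | 0, _ =>
    { Coins := Unit
      measurableSpace := inferInstance
      prob := Measure.dirac ()
      isProbabilityMeasure := inferInstance
      strategy := fun _ => (T 0).toStrategy
      measurable_strategy := fun _ => measurable_const }
  | n + 1, ε =>
    { Coins := ℕ → Fin (n + 1)
      measurableSpace := inferInstance
      prob := sampleMeasure n
      isProbabilityMeasure := inferInstance
      strategy := fun x => (race (hitTarget ε) x (T (n + 1)) 0 0).toStrategy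
      measurable_strategy := measurable_race _ _ 0 0 }

theorem le_hitTarget (ε : ℝ) : 64 / ε ^ 2 ≤ hitTarget ε := Nat.le_ceil _

theorem hitTarget_le (ε : ℝ) : (hitTarget ε : ℝ) ≤ 64 / ε ^ 2 + 1 :=
  (Nat.ceil_lt_add_one (by positivity)).le

theorem exp_sub_one_le {x : ℝ} (hx : |x| ≤ 1) : Real.exp x - 1 ≤ x + x ^ 2 := by
  have := Real.abs_exp_sub_one_sub_id_le hx
  linarith [le_abs_self (Real.exp x - 1 - x)]

theorem exp_neg_two_lt : Real.exp (-2) < 1 / 6 := by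
  have h : (2.7 : ℝ) < Real.exp 1 := by linarith [Real.exp_one_gt_d9]
  have h2 : Real.exp 2 = Real.exp 1 * Real.exp 1 := by rw [← Real.exp_add]; norm_num
  rw [Real.exp_neg, one_div]
  gcongr
  rw [h2]
  nlinarith

section

variable {n : ℕ} {ε : ℝ} {S : Finset (Fin (n + 1))}

/-- The sampling process is unlikely to take too long. -/
theorem real_few_hits_le (hε : 0 < ε) (hε1 : ε ≤ 1) (hS : S.Nonempty) :
    (sampleMeasure n).real {x | hits S x
      ⌊(1 + ε) * hitTarget ε * ((n + 1 : ℕ) : ℝ) / S.card⌋₊ ≤ hitTarget ε} ≤ 1 / 6 := by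
  set m := hitTarget ε with hm
  set t := ⌊(1 + ε) * m * ((n + 1 : ℕ) : ℝ) / S.card⌋₊ with ht
  refine (sampleMeasure.real_hits_le_le S t m (l := ε / 4) (by linarith)).trans ?_
  refine le_trans (Real.exp_le_exp.2 ?_) exp_neg_two_lt.le
  have hw : (0 : ℝ) < S.card := by exact_mod_cast hS.card_pos
  have hN : (0 : ℝ) < ((n + 1 : ℕ) : ℝ) := by positivity
  have hwN : (S.card : ℝ) ≤ ((n + 1 : ℕ) : ℝ) := by
    exact_mod_cast (Finset.card_le_univ S).trans (by simp)
  set p := (S.card : ℝ) / ((n + 1 : ℕ) : ℝ) with hp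
  have hp1 : p ≤ 1 := div_le_one_of_le₀ hwN hN.le
  have hp0 : 0 < p := by positivity
  have hpt : (1 + ε) * m - 1 ≤ p * t := by
    have h := Nat.lt_floor_add_one ((1 + ε) * m * ((n + 1 : ℕ) : ℝ) / S.card)
    rw [← ht] at h
    have h2 : p * ((1 + ε) * m * ((n + 1 : ℕ) : ℝ) / S.card) = (1 + ε) * m := by
      rw [hp]; field_simp
    nlinarith
  have hexp : Real.exp (-(ε / 4)) - 1 ≤ -(ε / 4) + (ε / 4) ^ 2 := by
    have := exp_sub_one_le (x := -(ε / 4)) (by rw [abs_neg, abs_of_pos] <;> linarith)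
    rwa [neg_sq] at this
  have hneg : -(ε / 4) + (ε / 4) ^ 2 ≤ 0 := by nlinarith
  have hmε : 64 ≤ (m : ℝ) * ε ^ 2 := by
    have := le_hitTarget ε
    rwa [div_le_iff₀ (by positivity), ← hm] at this
  have h1 : p * t * (Real.exp (-(ε / 4)) - 1) ≤ p * t * (-(ε / 4) + (ε / 4) ^ 2) := by gcongr
  have h2 : p * t * (-(ε / 4) + (ε / 4) ^ 2) ≤
      ((1 + ε) * m - 1) * (-(ε / 4) + (ε / 4) ^ 2) :=
    mul_le_mul_of_nonpos_right hpt hneg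
  have h3 : (m : ℝ) * ε ^ 3 ≤ m * ε ^ 2 := by
    have : ε ^ 3 ≤ ε ^ 2 := pow_le_pow_of_le_one hε.le hε1 (by norm_num)
    gcongr
  nlinarith

/-- The sampling process is unlikely to stop too early. -/
theorem real_many_hits_le (hε : 0 < ε) (hε1 : ε ≤ 1) (hS : S.Nonempty) :
    (sampleMeasure n).real {x | hitTarget ε ≤ hits S x
      ⌈hitTarget ε * ((n + 1 : ℕ) : ℝ) / ((1 + ε) * S.card)⌉₊} ≤ 1 / 6 := by
  set m := hitTarget ε with hm
  set t := ⌈m * ((n + 1 : ℕ) : ℝ) / ((1 + ε) * S.card)⌉₊ with ht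
  refine (sampleMeasure.real_hits_ge_le S t m (l := ε / 4) (by linarith)).trans ?_
  refine le_trans (Real.exp_le_exp.2 ?_) exp_neg_two_lt.le
  have hw : (0 : ℝ) < S.card := by exact_mod_cast hS.card_pos
  have hN : (0 : ℝ) < ((n + 1 : ℕ) : ℝ) := by positivity
  have hwN : (S.card : ℝ) ≤ ((n + 1 : ℕ) : ℝ) := by
    exact_mod_cast (Finset.card_le_univ S).trans (by simp)
  set p := (S.card : ℝ) / ((n + 1 : ℕ) : ℝ) with hp
  have hp1 : p ≤ 1 := div_le_one_of_le₀ hwN hN.le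
  have hp0 : 0 < p := by positivity
  have hpt : p * t ≤ m * (1 - ε / 2) + 1 := by
    have h := (Nat.ceil_lt_add_one
      (show 0 ≤ m * ((n + 1 : ℕ) : ℝ) / ((1 + ε) * S.card) by positivity))
    rw [← ht] at h
    have h2 : p * (m * ((n + 1 : ℕ) : ℝ) / ((1 + ε) * S.card)) = m / (1 + ε) := by
      rw [hp]; field_simp
    have h3 : (m : ℝ) / (1 + ε) ≤ m * (1 - ε / 2) := by
      rw [div_le_iff₀ (by linarith), mul_assoc]
      refine le_mul_of_one_le_right (by positivity) ?_
      nlinarith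
    nlinarith
  have hexp : Real.exp (ε / 4) - 1 ≤ ε / 4 + (ε / 4) ^ 2 :=
    exp_sub_one_le (by rw [abs_of_pos] <;> linarith)
  have hmε : 64 ≤ (m : ℝ) * ε ^ 2 := by
    have := le_hitTarget ε
    rwa [div_le_iff₀ (by positivity), ← hm] at this
  have h1 : p * t * (Real.exp (ε / 4) - 1) ≤ p * t * (ε / 4 + (ε / 4) ^ 2) := by gcongr
  have h2 : p * t * (ε / 4 + (ε / 4) ^ 2) ≤
      (m * (1 - ε / 2) + 1) * (ε / 4 + (ε / 4) ^ 2) := by gcongr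
  have h3 : 0 ≤ (m : ℝ) * ε ^ 3 := by positivity
  nlinarith

/-- When `t` samples are a large multiple `k` of the expected number needed, too few hits are
exponentially unlikely. -/
theorem real_few_hits_le_exp (hε : 0 < ε) (hε1 : ε ≤ 1) (hS : S.Nonempty) {k : ℝ} (hk : 1 ≤ k) :
    (sampleMeasure n).real {x | hits S x
      ⌊k * (150 * (((n + 1 : ℕ) : ℝ) / (S.card * ε ^ 2)))⌋₊ ≤ hitTarget ε} ≤ Real.exp (-k) := by
  set m := hitTarget ε with hm
  set t := ⌊k * (150 * (((n + 1 : ℕ) : ℝ) / (S.card * ε ^ 2)))⌋₊ with ht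
  refine (sampleMeasure.real_hits_le_le S t m (l := 1) (by norm_num)).trans ?_
  refine Real.exp_le_exp.2 ?_
  have hw : (0 : ℝ) < S.card := by exact_mod_cast hS.card_pos
  have hN : (0 : ℝ) < ((n + 1 : ℕ) : ℝ) := by positivity
  have hwN : (S.card : ℝ) ≤ ((n + 1 : ℕ) : ℝ) := by
    exact_mod_cast (Finset.card_le_univ S).trans (by simp)
  set p := (S.card : ℝ) / ((n + 1 : ℕ) : ℝ) with hp
  have hp1 : p ≤ 1 := div_le_one_of_le₀ hwN hN.le
  have hp0 : 0 < p := by positivity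
  have hpt : k * (150 / ε ^ 2) - 1 ≤ p * t := by
    have h := Nat.lt_floor_add_one (k * (150 * (((n + 1 : ℕ) : ℝ) / (S.card * ε ^ 2))))
    rw [← ht] at h
    have h2 : p * (k * (150 * (((n + 1 : ℕ) : ℝ) / (S.card * ε ^ 2)))) = k * (150 / ε ^ 2) := by
      rw [hp]; field_simp
    nlinarith
  have hexp : Real.exp (-1) - 1 ≤ -(1 / 2) := by
    have h : (2 : ℝ) < Real.exp 1 := by linarith [Real.exp_one_gt_d9]
    have : Real.exp (-1) < 1 / 2 := by
      rw [Real.exp_neg, one_div]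
      gcongr
    linarith
  have h1 : p * t * (Real.exp (-1) - 1) ≤ p * t * (-(1 / 2)) := by gcongr
  have hmle := hitTarget_le ε
  rw [← hm] at hmle
  have hq : 1 ≤ 1 / ε ^ 2 := by
    rw [le_div_iff₀ (by positivity), one_mul]
    exact pow_le_one₀ hε.le hε1
  have e1 : 150 / ε ^ 2 = 150 * (1 / ε ^ 2) := by ring
  have e2 : 64 / ε ^ 2 = 64 * (1 / ε ^ 2) := by ring
  rw [e1] at hpt
  rw [e2] at hmle
  nlinarith

end

theorem isSetSizeApproximation_raceAlgorithm {T : ∀ n, QueryTree n}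
    (hT : ∀ n S, (T n).value S = (S.card : ℝ)) (n : ℕ) {ε : ℝ} (hε : 0 < ε) (hε1 : ε ≤ 1) :
    (raceAlgorithm T n ε).IsSetSizeApproximation ε := by
  have hself : ∀ w : ℕ, IsEstimate ε w w := fun w => by
    have hw : (0 : ℝ) ≤ w := Nat.cast_nonneg w
    constructor
    · refine mul_le_of_le_one_left hw ?_
      rw [div_le_one (by linarith)]
      linarith
    · exact le_mul_of_one_le_left hw (by linarith)
  intro S _
  match n, S with
  | 0, S =>
    have huniv : {ω | ∃ r : ℝ, ((raceAlgorithm T 0 ε).strategy ω).Outputs S r ∧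
        IsEstimate ε S.card r} = Set.univ := by
      refine Set.eq_univ_of_forall fun ω => ⟨S.card, ?_, hself _⟩
      rw [← hT 0 S]
      exact outputs_value S (T 0)
    rw [huniv, RandomizedAlgorithm.Pr]
    let _ := (raceAlgorithm T 0 ε).measurableSpace
    let _ := (raceAlgorithm T 0 ε).isProbabilityMeasure
    rw [probReal_univ]
    norm_num
  | n + 1, S =>
    set m := hitTarget ε with hm
    set G : Set (ℕ → Fin (n + 1)) := {ω | ∃ r : ℝ,
      ((raceAlgorithm T (n + 1) ε).strategy ω).Outputs S r ∧ IsEstimate ε S.card r} with hG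
    have hgood : ∀ x : ℕ → Fin (n + 1),
        IsEstimate ε S.card ((race m x (T (n + 1)) 0 0).value S) →
        x ∈ G := fun x hx => ⟨_, outputs_value S _, hx⟩
    have hval : ∀ x : ℕ → Fin (n + 1), (race m x (T (n + 1)) 0 0).value S = S.card ∨
        ∃ t, hits S x t = m ∧
          (race m x (T (n + 1)) 0 0).value S = (m : ℝ) * ((n + 1 : ℕ) : ℝ) / t := by
      intro x
      have := value_race S x (T (n + 1)) (m := m) (j := 0) (by simp [hits])
      rwa [hT] at this
    have hmpos : 0 < m := by
      have := le_hitTarget ε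
      rw [← hm] at this
      have h2 : (0 : ℝ) < m := lt_of_lt_of_le (by positivity) this
      exact_mod_cast h2
    change 2 / 3 ≤ (sampleMeasure n).real G
    set t₀ := ⌊(1 + ε) * m * ((n + 1 : ℕ) : ℝ) / S.card⌋₊ with ht₀
    set t₁ := ⌈m * ((n + 1 : ℕ) : ℝ) / ((1 + ε) * S.card)⌉₊ with ht₁
    -- outside these two events the sampling process does not return a wrong value
    set B₀ : Set (ℕ → Fin (n + 1)) := {x | S.Nonempty ∧ hits S x t₀ ≤ m} with hB₀
    set B₁ : Set (ℕ → Fin (n + 1)) := {x | S.Nonempty ∧ m ≤ hits S x t₁} with hB₁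
    have hP₀ : (sampleMeasure n).real B₀ ≤ 1 / 6 := by
      by_cases hS : S.Nonempty
      · simpa only [hB₀, hS, true_and] using real_few_hits_le hε hε1 hS
      · simp [hB₀, hS]
    have hP₁ : (sampleMeasure n).real B₁ ≤ 1 / 6 := by
      by_cases hS : S.Nonempty
      · simpa only [hB₁, hS, true_and] using real_many_hits_le hε hε1 hS
      · simp [hB₁, hS]
    have hcover : (Set.univ : Set (ℕ → Fin (n + 1))) ⊆
        G ∪ (B₀ ∪ B₁) := by
      intro x _
      by_contra hx
      simp only [Set.mem_union, not_or] at hx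
      obtain ⟨hx, hx₀, hx₁⟩ := hx
      refine hx (hgood x ?_)
      rcases hval x with h | ⟨t, ht, h⟩
      · rw [h]; exact hself _
      have hS : S.Nonempty := by
        rw [Finset.nonempty_iff_ne_empty]
        rintro rfl
        simp [hits] at ht
        omega
      have hw : (0 : ℝ) < S.card := by exact_mod_cast hS.card_pos
      have hx₀ : m < hits S x t₀ := not_le.1 fun h => hx₀ ⟨hS, h⟩
      have hx₁ : hits S x t₁ < m := not_le.1 fun h => hx₁ ⟨hS, h⟩
      have hlt₀ : t ≤ t₀ := by
        by_contra hcon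
        have := hits_mono S x (not_le.1 hcon).le
        omega
      have hlt₁ : t₁ ≤ t := by
        by_contra hcon
        have := hits_mono S x (not_le.1 hcon).le
        omega
      have htpos : (0 : ℝ) < t := by
        rcases Nat.eq_zero_or_pos t with h0 | h0
        · subst h0
          simp [hits] at ht
          omega
        · exact_mod_cast h0
      have h₀ : (t : ℝ) ≤ (1 + ε) * m * ((n + 1 : ℕ) : ℝ) / S.card :=
        (Nat.cast_le.2 hlt₀).trans (Nat.floor_le (by positivity))
      have h₁ : m * ((n + 1 : ℕ) : ℝ) / ((1 + ε) * S.card) ≤ (t : ℝ) :=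
        (Nat.le_ceil _).trans (Nat.cast_le.2 hlt₁)
      rw [le_div_iff₀ hw] at h₀
      rw [div_le_iff₀ (by positivity)] at h₁
      rw [h]
      constructor
      · rw [le_div_iff₀ htpos, div_mul_eq_mul_div, one_mul, div_mul_eq_mul_div,
          div_le_iff₀ (by linarith)]
        nlinarith
      · rw [div_le_iff₀ htpos]
        nlinarith
    have h1 : (1 : ℝ) ≤ (sampleMeasure n).real G +
        ((sampleMeasure n).real B₀ + (sampleMeasure n).real B₁) := by
      calc (1 : ℝ) = (sampleMeasure n).real Set.univ := probReal_univ.symm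
        _ ≤ _ := measureReal_mono hcover
        _ ≤ _ := measureReal_union_le _ _
        _ ≤ _ := by gcongr; exact measureReal_union_le _ _
    linarith

theorem queries_raceAlgorithm_le (T : ∀ n, QueryTree n) (n : ℕ) (ε : ℝ) (S : Finset (Fin (n + 1)))
    (x : ℕ → Fin (n + 1)) :
    (raceAlgorithm T (n + 1) ε).queries S x ≤
      ENNReal.ofReal ((race (hitTarget ε) x (T (n + 1)) 0 0).cost S) := by
  rw [ENNReal.ofReal_natCast]
  have h : (((raceAlgorithm T (n + 1) ε).strategy x).numQueries S : ℕ∞) ≤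
      ((race (hitTarget ε) x (T (n + 1)) 0 0).cost S : ℕ∞) := numQueries_le_cost S _
  have := ENat.toENNReal_mono h
  rwa [ENat.toENNReal_coe] at this

/-- The exponential tail bound of the race, whatever the tree. -/
theorem real_queries_raceAlgorithm_le (T : ∀ n, QueryTree n) (n : ℕ) {ε : ℝ} (hε : 0 < ε)
    (hε1 : ε ≤ 1) {S : Finset (Fin n)} (hS : S.Nonempty) {k : ℝ} (hk : 1 ≤ k) :
    (raceAlgorithm T n ε).Pr {ω | ENNReal.ofReal (k * (300 * (n / (S.card * ε ^ 2)))) <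
      (raceAlgorithm T n ε).queries S ω} ≤ Real.exp (-k) := by
  match n, S, hS with
  | 0, S, hS => exact (Fin.elim0 hS.choose)
  | n + 1, S, hS =>
    refine le_trans ?_ (real_few_hits_le_exp (n := n) hε hε1 hS hk)
    refine measureReal_mono (μ := sampleMeasure n) ?_
    intro x hx
    by_contra hcon
    have hcon : hitTarget ε <
        hits S x ⌊k * (150 * (((n + 1 : ℕ) : ℝ) / (S.card * ε ^ 2)))⌋₊ := not_le.1 hcon
    refine absurd (show ENNReal.ofReal _ < _ from hx) (not_lt.2
      ((queries_raceAlgorithm_le T n ε S x).trans (ENNReal.ofReal_le_ofReal ?_)))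
    set t := ⌊k * (150 * (((n + 1 : ℕ) : ℝ) / (S.card * ε ^ 2)))⌋₊ with ht
    have h := cost_race_le_of_hits S x (T (n + 1)) hcon.le 0 (Nat.zero_le t)
    rw [show hits S x 0 = 0 by simp [hits]] at h
    have h2 : ((race (hitTarget ε) x (T (n + 1)) 0 0).cost S : ℝ) ≤ 2 * t := by
      exact_mod_cast (by omega : (race (hitTarget ε) x (T (n + 1)) 0 0).cost S ≤ 2 * t)
    have h3 : (t : ℝ) ≤ k * (150 * (((n + 1 : ℕ) : ℝ) / (S.card * ε ^ 2))) :=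
      Nat.floor_le (by positivity)
    linarith

theorem queriesBounded_raceAlgorithm (T : ∀ n, QueryTree n) :
    QueriesBoundedWithExponentialTail (raceAlgorithm T) := by
  intro δ hδ
  -- the factor that pushes the failure probability below `δ`
  set K := max 1 (-Real.log δ) with hK
  have hK1 : 1 ≤ K := le_max_left _ _
  have hKδ : Real.exp (-K) ≤ δ := by
    rw [← Real.le_log_iff_exp_le hδ]
    linarith [le_max_right 1 (-Real.log δ)]
  refine ⟨K * 300, by positivity, fun n ε hε hε1 S hS => ⟨?_, fun k hk => ?_⟩⟩
  · have h := real_queries_raceAlgorithm_le T n hε hε1 hS hK1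
    let _ := (raceAlgorithm T n ε).measurableSpace
    let _ := (raceAlgorithm T n ε).isProbabilityMeasure
    simp only [← mul_assoc] at h ⊢
    set A := raceAlgorithm T n ε
    have hcover : (Set.univ : Set A.Coins) ⊆
        {ω | A.queries S ω ≤ ENNReal.ofReal (K * 300 * (n / (S.card * ε ^ 2)))} ∪
        {ω | ENNReal.ofReal (K * 300 * (n / (S.card * ε ^ 2))) < A.queries S ω} :=
      fun ω _ => by
      simp only [Set.mem_union, Set.mem_ofPred_eq]
      exact le_or_gt _ _
    have h1 : (1 : ℝ) ≤ A.Pr _ + A.Pr _ :=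
      calc (1 : ℝ) = A.prob.real Set.univ := probReal_univ.symm
        _ ≤ _ := measureReal_mono hcover
        _ ≤ _ := measureReal_union_le _ _
    linarith
  · have h := real_queries_raceAlgorithm_le T n hε hε1 hS (k := k * K) (by nlinarith)
    rw [show k * K * (300 * ((n : ℝ) / (S.card * ε ^ 2))) =
      k * (K * 300 * (n / (S.card * ε ^ 2))) by ring] at h
    refine h.trans (Real.exp_le_exp.2 ?_)
    nlinarith

theorem nonAdaptive_raceAlgorithm_scan (n : ℕ) (ε : ℝ) :
    (raceAlgorithm (fun n => scan (List.finRange n) 0) n ε).NonAdaptive := by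
  match n with
  | 0 =>
    intro ω h h' I
    exact Fin.elim0 I.fst
  | n + 1 =>
    intro x h h' I I' hlen hI hI'
    exact nonAdaptive_race_scan _ _ _ _ _ _ _ _ _ _ _ _ hlen hI hI'

theorem queries_raceAlgorithm_searchAll_le :
    ∃ C : ℝ, 0 < C ∧ ∀ (n : ℕ) (ε : ℝ), 2 ≤ n → 0 < ε → ε ≤ 1 →
      ∀ (S : Finset (Fin n)) (ω : (raceAlgorithm searchAll n ε).Coins),
        (raceAlgorithm searchAll n ε).queries S ω ≤
          ENNReal.ofReal (C * (max (S.card : ℝ) 1 * Real.log n)) := by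
  refine ⟨16, by norm_num, fun n ε hn _ _ S ω => ?_⟩
  match n, S, ω, hn with
  | n + 1, S, x, hn =>
    refine (queries_raceAlgorithm_le _ n ε S x).trans (ENNReal.ofReal_le_ofReal ?_)
    have h1 := cost_race_le_two_mul S (m := hitTarget ε) x (searchAll (n + 1)) 0
    rw [show hits S x 0 = 0 by simp [hits]] at h1
    have h2 := cost_searchAll_le S
    have hclog : ((Nat.clog 2 (n + 1) : ℕ) : ℝ) ≤ 3 * Real.log ((n + 1 : ℕ) : ℝ) := by
      have h3 : 2 ^ (Nat.clog 2 (n + 1) - 1) < n + 1 :=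
        Nat.pow_pred_clog_lt_self (by norm_num) (by omega)
      have h4 : 0 < Nat.clog 2 (n + 1) := Nat.clog_pos (by norm_num) hn
      have h5 : ((Nat.clog 2 (n + 1) : ℝ) - 1) * Real.log 2 ≤ Real.log ((n + 1 : ℕ) : ℝ) := by
        have := Real.log_le_log (by positivity)
          (Nat.cast_le (α := ℝ).2 h3.le)
        rw [Nat.cast_pow, Real.log_pow, Nat.cast_sub h4] at this
        exact_mod_cast this
      have h6 : Real.log 2 ≤ Real.log ((n + 1 : ℕ) : ℝ) :=
        Real.log_le_log (by norm_num) (by exact_mod_cast hn)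
      have h7 := Real.log_two_gt_d9
      have h8 : (1 : ℝ) ≤ Nat.clog 2 (n + 1) := by exact_mod_cast h4
      nlinarith
    have hlog : 1 / 2 ≤ Real.log ((n + 1 : ℕ) : ℝ) := by
      have h6 : Real.log 2 ≤ Real.log ((n + 1 : ℕ) : ℝ) :=
        Real.log_le_log (by norm_num) (by exact_mod_cast hn)
      linarith [Real.log_two_gt_d9]
    have h9 : ((race (hitTarget ε) x (searchAll (n + 1)) 0 0).cost S : ℝ) ≤
        2 * (1 + 2 * (Nat.clog 2 (n + 1) * S.card)) := by
      exact_mod_cast h1.trans (Nat.mul_le_mul_left 2 h2)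
    refine h9.trans ?_
    set l := Real.log ((n + 1 : ℕ) : ℝ)
    set W := max (S.card : ℝ) 1
    have hW1 : 1 ≤ W := le_max_right _ _
    have hWS : (S.card : ℝ) ≤ W := le_max_left _ _
    have h10 : (Nat.clog 2 (n + 1) : ℝ) * S.card ≤ 3 * l * W := by gcongr
    nlinarith

end UpperBounds

/-! ### From indistinguishable families to a lower bound -/

namespace Strategy

variable {n : ℕ}

theorem length_transcript_of_inl {σ : Strategy n} {S : Finset (Fin n)} {t : ℕ}
    {I : IntervalQuery n} (h : σ (σ.transcript S t) = Sum.inl I) :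
    (σ.transcript S t).length = t := by
  induction t generalizing I with
  | zero => rfl
  | succ t ih =>
    cases h' : σ (σ.transcript S t) with
    | inl J => rw [transcript_succ_inl h', List.length_append, ih h', List.length_singleton]
    | inr r =>
      rw [transcript_succ_inr h', h'] at h
      cases h

/-- A run with at most `t` queries has stopped after `t` steps. -/
theorem exists_inr_of_numQueries_lt {σ : Strategy n} {S : Finset (Fin n)} {t : ℕ}
    (h : σ.numQueries S < ((t + 1 : ℕ) : ℕ∞)) : ∃ r, σ (σ.transcript S t) = Sum.inr r := by
  cases h' : σ (σ.transcript S t) with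
  | inr r => exact ⟨r, rfl⟩
  | inl I =>
    refine absurd h (not_lt.2 ?_)
    have h1 : ((σ.transcript S (t + 1)).length : ℕ∞) ≤ σ.numQueries S :=
      le_iSup (fun t => ((σ.transcript S t).length : ℕ∞)) (t + 1)
    rwa [transcript_succ_inl h', List.length_append, length_transcript_of_inl h',
      List.length_singleton] at h1

end Strategy

namespace RandomizedAlgorithm

variable {n : ℕ} (A : RandomizedAlgorithm n)

attribute [local instance] RandomizedAlgorithm.measurableSpace
  RandomizedAlgorithm.isProbabilityMeasure

theorem measurableSet_transcript_eq (S : Finset (Fin n)) (t : ℕ) (h : List Bool) :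
    MeasurableSet {ω | (A.strategy ω).transcript S t = h} := by
  induction t generalizing h with
  | zero => exact MeasurableSet.const ([] = h)
  | succ t ih =>
    have heq : {ω | (A.strategy ω).transcript S (t + 1) = h} =
        ⋃ l : List Bool, {ω | (A.strategy ω).transcript S t = l} ∩
          (fun ω => A.strategy ω l) ⁻¹'
            {s | s.elim (fun I => l ++ [I.answer S] = h) fun _ => l = h} := by
      ext ω
      simp only [Set.mem_ofPred_eq, Set.mem_iUnion, Set.mem_inter_iff, Set.mem_preimage,
        exists_eq_left']
      cases h' : A.strategy ω ((A.strategy ω).transcript S t) with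
      | inl I => rw [Strategy.transcript_succ_inl h']; rfl
      | inr r => rw [Strategy.transcript_succ_inr h']; rfl
    rw [heq]
    refine MeasurableSet.iUnion fun l => (ih l).inter (A.measurable_strategy l ?_)
    rw [measurableSet_sum_iff]
    exact ⟨MeasurableSet.of_discrete, MeasurableSet.const (l = h)⟩

theorem measurableSet_outputs (S : Finset (Fin n)) {P : Set ℝ} (hP : MeasurableSet P) :
    MeasurableSet {ω | ∃ r : ℝ, (A.strategy ω).Outputs S r ∧ r ∈ P} := by
  have heq : {ω | ∃ r : ℝ, (A.strategy ω).Outputs S r ∧ r ∈ P} =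
      ⋃ t : ℕ, ⋃ l : List Bool, {ω | (A.strategy ω).transcript S t = l} ∩
        (fun ω => A.strategy ω l) ⁻¹' (Sum.inr '' P) := by
    ext ω
    simp only [Set.mem_ofPred_eq, Set.mem_iUnion, Set.mem_inter_iff, Set.mem_preimage,
      exists_eq_left', Set.mem_image]
    constructor
    · rintro ⟨r, ⟨t, ht⟩, hr⟩
      exact ⟨t, r, hr, ht.symm⟩
    · rintro ⟨t, r, hr, ht⟩
      exact ⟨r, ⟨t, ht.symm⟩, hr⟩
  rw [heq]
  exact MeasurableSet.iUnion fun t => MeasurableSet.iUnion fun l =>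
    (A.measurableSet_transcript_eq S t l).inter (A.measurable_strategy l hP.inr_image)

theorem measurableSet_transcript_ne (S S' : Finset (Fin n)) (t : ℕ) :
    MeasurableSet {ω | (A.strategy ω).transcript S t ≠ (A.strategy ω).transcript S' t} := by
  have heq : {ω | (A.strategy ω).transcript S t = (A.strategy ω).transcript S' t} =
      ⋃ l : List Bool, {ω | (A.strategy ω).transcript S' t = l} ∩
        {ω | (A.strategy ω).transcript S t = l} := by
    ext ω
    simp
  have : MeasurableSet {ω | (A.strategy ω).transcript S t = (A.strategy ω).transcript S' t} := by
    rw [heq]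
    exact MeasurableSet.iUnion fun l =>
      (A.measurableSet_transcript_eq S' t l).inter (A.measurableSet_transcript_eq S t l)
  exact this.compl

theorem Pr_not_outputs_estimate_le {ε : ℝ} {K : Set ℕ} (hA : A.ApproximatesOn ε K)
    (S : Finset (Fin n)) (hS : S.card ∈ K) :
    A.prob.real {ω | ∃ r : ℝ, (A.strategy ω).Outputs S r ∧ IsEstimate ε S.card r}ᶜ ≤ 1 / 3 := by
  have hmeas : MeasurableSet
      {ω | ∃ r : ℝ, (A.strategy ω).Outputs S r ∧ IsEstimate ε S.card r} :=
    A.measurableSet_outputs S (P := Set.Icc (1 / (1 + ε) * (S.card : ℝ)) ((1 + ε) * (S.card : ℝ)))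
      measurableSet_Icc
  have h : 2 / 3 ≤ A.prob.real
      {ω | ∃ r : ℝ, (A.strategy ω).Outputs S r ∧ IsEstimate ε S.card r} := hA S hS
  rw [probReal_compl_eq_one_sub hmeas]
  linarith

/-- If no number estimates both sizes `a` and `b`, and if for all coin tosses the first `t` answers
tell apart sets of sizes `a` and `b` from some third set for only a small fraction of the members
`z` of a family, then on some of the third sets more than `t` queries are likely: a run that
stopped earlier would give the same output on all three sets. -/
theorem exists_quarter_le_Pr_queries {Z : Type*} [Fintype Z] [Nonempty Z]
    (Sa Sw Sb : Z → Finset (Fin n)) {a b : ℕ} {ε : ℝ}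
    (hab : ∀ r, ¬ (IsEstimate ε a r ∧ IsEstimate ε b r))
    (ha : ∀ z, (Sa z).card = a) (hb : ∀ z, (Sb z).card = b)
    {K : Set ℕ} (haK : a ∈ K) (hbK : b ∈ K) (hA : A.ApproximatesOn ε K) (t : ℕ)
    (hD : ∀ ω, ((Finset.univ.filter fun z =>
      (A.strategy ω).transcript (Sa z) t ≠ (A.strategy ω).transcript (Sw z) t ∨
      (A.strategy ω).transcript (Sb z) t ≠ (A.strategy ω).transcript (Sw z) t).card : ℝ) ≤
        Fintype.card Z / 12) :
    ∃ z, 1 / 4 ≤ A.Pr {ω | ((t + 1 : ℕ) : ℝ≥0∞) ≤ A.queries (Sw z) ω} := by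
  set D : Z → Set A.Coins := fun z =>
    {ω | (A.strategy ω).transcript (Sa z) t ≠ (A.strategy ω).transcript (Sw z) t} ∪
      {ω | (A.strategy ω).transcript (Sb z) t ≠ (A.strategy ω).transcript (Sw z) t} with hDdef
  have hDmeas : ∀ z, MeasurableSet (D z) := fun z =>
    (A.measurableSet_transcript_ne _ _ t).union (A.measurableSet_transcript_ne _ _ t)
  have hDint : ∀ z, Integrable ((D z).indicator (1 : A.Coins → ℝ)) A.prob := fun z =>
    (integrable_const (1 : ℝ)).indicator (hDmeas z)
  have hsum : ∑ z, A.prob.real (D z) ≤ Fintype.card Z / 12 := by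
    have h1 : ∑ z, A.prob.real (D z) = ∫ ω, ∑ z, (D z).indicator 1 ω ∂A.prob := by
      rw [integral_finsetSum _ fun z _ => hDint z]
      refine Finset.sum_congr rfl fun z _ => ?_
      rw [integral_indicator_one (hDmeas z)]
    rw [h1]
    calc ∫ ω, ∑ z, (D z).indicator 1 ω ∂A.prob
        ≤ ∫ _, ((Fintype.card Z : ℝ) / 12) ∂A.prob := by
          refine integral_mono (integrable_finsetSum _ fun z _ => hDint z)
            (integrable_const _) fun ω => ?_
          refine le_trans (le_of_eq ?_) (hD ω)
          classical
          rw [Finset.card_filter]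
          push_cast
          refine Finset.sum_congr rfl fun z _ => ?_
          simp [hDdef, Set.indicator_apply]
      _ = (Fintype.card Z : ℝ) / 12 := by simp
  by_contra hcon
  push Not at hcon
  have hlt : ∀ z, 1 / 12 < A.prob.real (D z) := by
    intro z
    have hN : A.prob.real {ω | ((t + 1 : ℕ) : ℝ≥0∞) ≤ A.queries (Sw z) ω} < 1 / 4 := hcon z
    have hGa := A.Pr_not_outputs_estimate_le hA (Sa z) (by rw [ha]; exact haK)
    have hGb := A.Pr_not_outputs_estimate_le hA (Sb z) (by rw [hb]; exact hbK)
    rw [ha] at hGa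
    rw [hb] at hGb
    set N := {ω | ((t + 1 : ℕ) : ℝ≥0∞) ≤ A.queries (Sw z) ω} with hNdef
    set Ga := {ω | ∃ r : ℝ, (A.strategy ω).Outputs (Sa z) r ∧ IsEstimate ε a r} with hGadef
    set Gb := {ω | ∃ r : ℝ, (A.strategy ω).Outputs (Sb z) r ∧ IsEstimate ε b r} with hGbdef
    have hcover : (Set.univ : Set A.Coins) ⊆ (Gaᶜ ∪ Gbᶜ) ∪ (N ∪ D z) := by
      intro ω _
      by_contra hω
      simp only [Set.mem_union, Set.mem_compl_iff, not_or, not_not] at hω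
      obtain ⟨⟨⟨r, hr, hra⟩, r', hr', hrb⟩, hωN, hωD⟩ := hω
      simp only [hDdef, Set.mem_union, Set.mem_ofPred_eq, not_or, not_not] at hωD
      have hlt : (A.strategy ω).numQueries (Sw z) < ((t + 1 : ℕ) : ℕ∞) := by
        have h1 : A.queries (Sw z) ω < ((t + 1 : ℕ) : ℝ≥0∞) := not_le.1 hωN
        rw [queries, ← ENat.toENNReal_coe, ENat.toENNReal_lt] at h1
        exact h1
      obtain ⟨q, hq⟩ := Strategy.exists_inr_of_numQueries_lt hlt
      have hqa : (A.strategy ω).Outputs (Sa z) q := ⟨t, by rw [hωD.1, hq]⟩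
      have hqb : (A.strategy ω).Outputs (Sb z) q := ⟨t, by rw [hωD.2, hq]⟩
      rw [hr.unique hqa] at hra
      rw [hr'.unique hqb] at hrb
      exact hab q ⟨hra, hrb⟩
    have h1 : (1 : ℝ) ≤ (A.prob.real Gaᶜ + A.prob.real Gbᶜ) +
        (A.prob.real N + A.prob.real (D z)) :=
      calc (1 : ℝ) = A.prob.real Set.univ := probReal_univ.symm
        _ ≤ _ := measureReal_mono hcover
        _ ≤ _ := measureReal_union_le _ _
        _ ≤ _ := add_le_add (measureReal_union_le _ _) (measureReal_union_le _ _)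
    linarith
  have h2 : ∑ _z : Z, (1 / 12 : ℝ) < ∑ z, A.prob.real (D z) :=
    Finset.sum_lt_sum_of_nonempty Finset.univ_nonempty fun z _ => hlt z
  rw [Finset.sum_const, Finset.card_univ, nsmul_eq_mul] at h2
  linarith

/-- Without any query nothing is known about the set. -/
theorem quarter_le_Pr_one_le_queries {Sa Sb : Finset (Fin n)} {ε : ℝ}
    (hab : ∀ r, ¬ (IsEstimate ε Sa.card r ∧ IsEstimate ε Sb.card r))
    {K : Set ℕ} (haK : Sa.card ∈ K) (hbK : Sb.card ∈ K) (hA : A.ApproximatesOn ε K)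
    (S : Finset (Fin n)) : 1 / 4 ≤ A.Pr {ω | ((0 + 1 : ℕ) : ℝ≥0∞) ≤ A.queries S ω} := by
  obtain ⟨-, h⟩ := A.exists_quarter_le_Pr_queries (Z := Unit) (fun _ => Sa) (fun _ => S)
    (fun _ => Sb) hab (fun _ => rfl) (fun _ => rfl) haK hbK hA 0 fun ω => by
      simp [Strategy.transcript]
  exact h

end RandomizedAlgorithm

/-! ### The hard sets -/

section HardSets

/-- The index of the `j`-th cell of the `i`-th block, where all blocks have `m` cells. -/
def cellIndex {k m : ℕ} (i : Fin k) (j : Fin m) : ℕ := i * m + j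

theorem cellIndex_injective {k m : ℕ} {i i' : Fin k} {j j' : Fin m}
    (h : cellIndex i j = cellIndex i' j') : i = i' ∧ j = j' := by
  unfold cellIndex at h
  have hm : 0 < m := j.pos
  have h1 : (i : ℕ) = i' := by
    have h2 := congrArg (· / m) h
    simpa [Nat.mul_add_div hm, mul_comm _ m, Nat.div_eq_of_lt j.isLt, Nat.div_eq_of_lt j'.isLt]
      using h2
  refine ⟨Fin.ext h1, Fin.ext ?_⟩
  rw [h1] at h
  omega

theorem cellIndex_lt {k m : ℕ} (i : Fin k) (j : Fin m) : cellIndex i j < k * m := by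
  unfold cellIndex
  calc (i : ℕ) * m + j < i * m + m := by omega
    _ = (i + 1) * m := by ring
    _ ≤ k * m := Nat.mul_le_mul_right m i.isLt

variable {n k m : ℕ}

/-- The base positions: in the `i`-th of `k` blocks of `m` cells of length `B`, the first position
of the cell `y i`; and `f` positions to the right of all blocks. -/
def basePositions (B f : ℕ) (y : Fin k → Fin m) : Finset ℕ :=
  (Finset.univ.image fun i => cellIndex i (y i) * B) ∪ Finset.Ico (k * m * B) (k * m * B + f)

/-- The `e` positions after the base position of the block `i`. -/
def extraPositions (B e : ℕ) (y : Fin k → Fin m) (i : Fin k) : Finset ℕ :=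
  Finset.Ioc (cellIndex i (y i) * B) (cellIndex i (y i) * B + e)

/-- The set with all base positions and `e` extra positions in the block `i`. -/
def hardSet (n B f e : ℕ) (y : Fin k → Fin m) (i : Fin k) : Finset (Fin n) :=
  Finset.univ.filter fun x => x.val ∈ basePositions B f y ∪ extraPositions B e y i

/-- The set with the base positions only. -/
def baseSet (n B f : ℕ) (y : Fin k → Fin m) : Finset (Fin n) :=
  Finset.univ.filter fun x => x.val ∈ basePositions B f y

theorem hardSet_zero (B f : ℕ) (y : Fin k → Fin m) (i : Fin k) :
    hardSet n B f 0 y i = baseSet n B f y := by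
  simp [hardSet, baseSet, extraPositions]

theorem card_filter_val_mem {T : Finset ℕ} (hT : ∀ x ∈ T, x < n) :
    (Finset.univ.filter fun x : Fin n => x.val ∈ T).card = T.card := by
  rw [← Finset.card_map Fin.valEmbedding]
  congr 1
  ext x
  simp only [Finset.mem_map, Finset.mem_filter, Finset.mem_univ, true_and, Fin.valEmbedding_apply]
  constructor
  · rintro ⟨z, hz, rfl⟩
    exact hz
  · intro hx
    exact ⟨⟨x, hT x hx⟩, hx, rfl⟩

theorem card_hardSet {B f e : ℕ} (he : e < B) (hn : k * m * B + f ≤ n) (y : Fin k → Fin m)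
    (i : Fin k) : (hardSet n B f e y i).card = k + f + e := by
  have hB : 0 < B := by omega
  have hcell : ∀ i', cellIndex i' (y i') * B + B ≤ k * m * B := fun i' => by
    have := Nat.mul_le_mul_right B (cellIndex_lt i' (y i'))
    rwa [Nat.succ_mul] at this
  have hdisj1 : Disjoint (Finset.univ.image fun i => cellIndex i (y i) * B)
      (Finset.Ico (k * m * B) (k * m * B + f)) := by
    rw [Finset.disjoint_left]
    intro x hx hx'
    obtain ⟨i', -, rfl⟩ := Finset.mem_image.1 hx
    have := hcell i'
    have := (Finset.mem_Ico.1 hx').1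
    omega
  have hdisj2 : Disjoint (basePositions B f y) (extraPositions B e y i) := by
    rw [Finset.disjoint_left]
    intro x hx hx'
    have hx' := Finset.mem_Ioc.1 hx'
    rcases Finset.mem_union.1 hx with hx | hx
    · obtain ⟨i', -, rfl⟩ := Finset.mem_image.1 hx
      have h1 : cellIndex i (y i) < cellIndex i' (y i') := lt_of_mul_lt_mul_right hx'.1 hB.le
      have h2 := Nat.mul_le_mul_right B h1
      rw [Nat.succ_mul] at h2
      omega
    · have := hcell i
      have := (Finset.mem_Ico.1 hx).1
      omega
  rw [hardSet, card_filter_val_mem, Finset.card_union_of_disjoint hdisj2, basePositions,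
    Finset.card_union_of_disjoint hdisj1, Finset.card_image_of_injective, extraPositions]
  · simp
  · intro i₁ i₂ h
    exact (cellIndex_injective (Nat.eq_of_mul_eq_mul_right hB h)).1
  · intro x hx
    simp only [basePositions, extraPositions, Finset.mem_union, Finset.mem_image,
      Finset.mem_univ, true_and, Finset.mem_Ico, Finset.mem_Ioc] at hx
    rcases hx with (⟨i', rfl⟩ | hx) | hx
    · have := hcell i'; omega
    · omega
    · have := hcell i; omega

/-- Only a query whose left end lies in the cell of the extra elements can reveal them, as their
cell starts with a base element. -/
theorem fst_div_eq_of_answer_ne {B f e : ℕ} (he : e < B) (y : Fin k → Fin m) (i : Fin k)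
    (I : IntervalQuery n) (h : I.answer (hardSet n B f e y i) ≠ I.answer (baseSet n B f y)) :
    I.fst.val / B = cellIndex i (y i) := by
  have hB : 0 < B := by omega
  have hsub : baseSet n B f y ⊆ hardSet n B f e y i := fun x hx =>
    Finset.mem_filter.2 ⟨Finset.mem_univ _,
      Finset.mem_union_left _ (Finset.mem_filter.1 hx).2⟩
  have hno : ¬ ∃ x ∈ baseSet n B f y, I.fst ≤ x ∧ x ≤ I.snd := by
    rintro ⟨x, hx, hx'⟩
    apply h
    have h1 : ∃ x ∈ hardSet n B f e y i, I.fst ≤ x ∧ x ≤ I.snd := ⟨x, hsub hx, hx'⟩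
    have h2 : ∃ x ∈ baseSet n B f y, I.fst ≤ x ∧ x ≤ I.snd := ⟨x, hx, hx'⟩
    simp only [IntervalQuery.answer, h1, h2]
  have hyes : ∃ x ∈ hardSet n B f e y i, I.fst ≤ x ∧ x ≤ I.snd := by
    by_contra hcon
    exact h (by simp only [IntervalQuery.answer, hno, hcon])
  obtain ⟨x, hx, hx1, hx2⟩ := hyes
  have hxe : x.val ∈ extraPositions B e y i := by
    rcases Finset.mem_union.1 (Finset.mem_filter.1 hx).2 with hb | hb
    · exact absurd ⟨x, Finset.mem_filter.2 ⟨Finset.mem_univ _, hb⟩, hx1, hx2⟩ hno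
    · exact hb
  have hxe := Finset.mem_Ioc.1 hxe
  have hx1' : I.fst.val ≤ x.val := hx1
  have hx2' : x.val ≤ I.snd.val := hx2
  have hfst : cellIndex i (y i) * B < I.fst.val := by
    by_contra hcon
    refine hno ⟨⟨cellIndex i (y i) * B, by have := x.isLt; omega⟩,
      Finset.mem_filter.2 ⟨Finset.mem_univ _, Finset.mem_union_left _
        (Finset.mem_image.2 ⟨i, Finset.mem_univ _, rfl⟩)⟩, ?_, ?_⟩
    · rw [Fin.le_def]; exact not_lt.1 hcon
    · rw [Fin.le_def]
      change cellIndex i (y i) * B ≤ I.snd.val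
      omega
  rw [Nat.div_eq_iff hB]
  constructor
  · omega
  · omega

/-! ### The cells that a strategy asks for -/

/-- The cells, of length `B`, that contain the left end of the query after the history `h`. -/
def queriedCell (σ : Strategy n) (B : ℕ) (h : List Bool) : Finset ℕ :=
  (σ h).elim (fun I => {I.fst.val / B}) fun _ => ∅

/-- The cells that contain the left end of some query on the way to the history `h`. -/
def queriedCells (σ : Strategy n) (B : ℕ) (h : List Bool) : Finset ℕ :=
  (Finset.range h.length).biUnion fun s => queriedCell σ B (h.take s)

theorem card_queriedCell_le (σ : Strategy n) (B : ℕ) (h : List Bool) :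
    (queriedCell σ B h).card ≤ 1 := by
  unfold queriedCell
  cases σ h <;> simp

theorem card_queriedCells_le (σ : Strategy n) (B : ℕ) (h : List Bool) :
    (queriedCells σ B h).card ≤ h.length := by
  have := Finset.card_biUnion_le_card_mul (Finset.range h.length)
    (fun s => queriedCell σ B (h.take s)) 1 fun s _ => card_queriedCell_le σ B _
  simpa [queriedCells] using this

theorem queriedCells_append (σ : Strategy n) (B : ℕ) (h : List Bool) (b : Bool) :
    queriedCells σ B (h ++ [b]) = queriedCell σ B h ∪ queriedCells σ B h := by
  unfold queriedCells
  rw [List.length_append, List.length_singleton, Finset.range_add_one, Finset.biUnion_insert]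
  congr 1
  · simp
  · refine Finset.biUnion_congr rfl fun s hs => ?_
    rw [List.take_append_of_le_length (Finset.mem_range.1 hs).le]

/-- As long as the cell of the extra elements is not queried, they have no influence on the run. -/
theorem transcript_hardSet_eq {B f e : ℕ} (he : e < B) (y : Fin k → Fin m) (i : Fin k)
    (σ : Strategy n) (t : ℕ)
    (h : cellIndex i (y i) ∉ queriedCells σ B (σ.transcript (baseSet n B f y) t)) :
    σ.transcript (hardSet n B f e y i) t = σ.transcript (baseSet n B f y) t := by
  induction t with
  | zero => rfl
  | succ t ih =>
    cases h' : σ (σ.transcript (baseSet n B f y) t) with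
    | inl I =>
      rw [Strategy.transcript_succ_inl h', queriedCells_append, Finset.mem_union, not_or] at h
      have hI : I.answer (hardSet n B f e y i) = I.answer (baseSet n B f y) := by
        by_contra hne
        apply h.1
        rw [queriedCell, h', ← fst_div_eq_of_answer_ne he y i I hne]
        simp
      have hih := ih h.2
      rw [Strategy.transcript_succ_inl h', Strategy.transcript_succ_inl (I := I) (by rw [hih, h']),
        hih, hI]
    | inr r =>
      rw [Strategy.transcript_succ_inr h'] at h
      have hih := ih h
      rw [Strategy.transcript_succ_inr h', Strategy.transcript_succ_inr (r := r) (by rw [hih, h']),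
        hih]

/-- The pairs of a choice of base cells and of a block whose base cell is queried within the first
`t` steps. -/
def foundPairs (σ : Strategy n) (B f t : ℕ) : Finset ((Fin k → Fin m) × Fin k) :=
  Finset.univ.filter fun z =>
    cellIndex z.2 (z.1 z.2) ∈ queriedCells σ B (σ.transcript (baseSet n B f z.1) t)

/-- The lower bound that follows when few base cells are found. -/
theorem RandomizedAlgorithm.exists_card_eq_and_quarter_le_Pr (A : RandomizedAlgorithm n)
    {a w b B f t : ℕ} {ε : ℝ} (hab : ∀ r, ¬ (IsEstimate ε a r ∧ IsEstimate ε b r))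
    {K : Set ℕ} (haK : a ∈ K) (hbK : b ∈ K) (hA : A.ApproximatesOn ε K)
    (haw : a ≤ w) (hwb : w ≤ b) (hB : b - a < B) (hk : 0 < k) (hm : 0 < m) (hf : k + f = a)
    (hn : k * m * B + f ≤ n)
    (hfound : ∀ ω, ((foundPairs (k := k) (m := m) (A.strategy ω) B f t).card : ℝ) ≤
      (m : ℝ) ^ k * k / 12) :
    ∃ S : Finset (Fin n), S.card = w ∧
      1 / 4 ≤ A.Pr {ω | ((t + 1 : ℕ) : ℝ≥0∞) ≤ A.queries S ω} := by
  have : Nonempty ((Fin k → Fin m) × Fin k) := ⟨(fun _ => ⟨0, hm⟩, ⟨0, hk⟩)⟩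
  obtain ⟨z, hz⟩ := A.exists_quarter_le_Pr_queries (Z := (Fin k → Fin m) × Fin k)
    (fun z => baseSet n B f z.1) (fun z => hardSet n B f (w - a) z.1 z.2)
    (fun z => hardSet n B f (b - a) z.1 z.2) hab
    (fun z => by rw [← hardSet_zero B f z.1 z.2, card_hardSet (by omega) hn]; omega)
    (fun z => by rw [card_hardSet (by omega) hn]; omega) haK hbK hA t (fun ω => by
      have hcard : Fintype.card ((Fin k → Fin m) × Fin k) = m ^ k * k := by simp
      rw [hcard]
      push_cast
      refine le_trans ?_ (hfound ω)
      rw [Nat.cast_le]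
      refine Finset.card_le_card fun z hz => ?_
      simp only [foundPairs, Finset.mem_filter, Finset.mem_univ, true_and] at hz ⊢
      by_contra hcon
      have h1 := transcript_hardSet_eq (e := w - a) (by omega) z.1 z.2 (A.strategy ω) t hcon
      have h2 := transcript_hardSet_eq (e := b - a) (by omega) z.1 z.2 (A.strategy ω) t hcon
      rw [h1, h2] at hz
      simp at hz)
  exact ⟨_, by rw [card_hardSet (by omega) hn]; omega, hz⟩

/-! ### Few base cells are found -/

theorem card_foundPairs_le_of_subset (σ : Strategy n) {B f t : ℕ} (hkm : k = 1 ∨ m = 1)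
    {U : Finset ℕ} (hU : ∀ y : Fin k → Fin m,
      queriedCells σ B (σ.transcript (baseSet n B f y) t) ⊆ U) :
    (foundPairs (k := k) (m := m) σ B f t).card ≤ U.card := by
  refine Finset.card_le_card_of_injOn (fun z => cellIndex z.2 (z.1 z.2)) ?_ ?_
  · intro z hz
    exact hU z.1 (Finset.mem_filter.1 hz).2
  · rintro ⟨y, i⟩ - ⟨y', i'⟩ - h
    obtain ⟨h1, h2⟩ := cellIndex_injective h
    simp only at h1 h2
    subst h1
    rcases hkm with rfl | rfl
    · have : y = y' := by
        funext j
        rw [Subsingleton.elim j i]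
        exact h2
      rw [this]
    · rw [Subsingleton.elim y y']

/-- With a single cell in each block, every query finds at most one block. -/
theorem card_foundPairs_one_le (σ : Strategy n) (B f t : ℕ) :
    (foundPairs (k := k) (m := 1) σ B f t).card ≤ t := by
  refine (card_foundPairs_le_of_subset σ (Or.inr rfl) (fun y => ?_)).trans
    ((card_queriedCells_le σ B (σ.transcript (baseSet n B f fun _ : Fin k => (0 : Fin 1)) t)).trans
      (Strategy.length_transcript_le _ _ _))
  rw [Subsingleton.elim y fun _ => 0]

/-- With a single block, the fixed queries of a non-adaptive strategy find at most one cell each. -/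
theorem card_foundPairs_le_of_nonAdaptive {σ : Strategy n} (hσ : σ.NonAdaptive) (B f t : ℕ) :
    (foundPairs (k := 1) (m := m) σ B f t).card ≤ t := by
  classical
  set q : ℕ → Finset ℕ := fun s =>
    if h : ∃ l : List Bool, l.length = s ∧ ∃ I, σ l = Sum.inl I then
      queriedCell σ B h.choose else ∅ with hq
  have hqcard : ∀ s, (q s).card ≤ 1 := by
    intro s
    simp only [hq]
    split_ifs
    · exact card_queriedCell_le σ B _
    · simp
  have hsub : ∀ l : List Bool, queriedCell σ B l ⊆ q l.length := by
    intro l x hx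
    cases hl : σ l with
    | inr r => simp [queriedCell, hl] at hx
    | inl I =>
      have hex : ∃ l' : List Bool, l'.length = l.length ∧ ∃ I, σ l' = Sum.inl I :=
        ⟨l, rfl, I, hl⟩
      obtain ⟨hlen, I', hI'⟩ := hex.choose_spec
      simp only [hq, dif_pos hex]
      rw [queriedCell, hI', ← hσ l hex.choose I I' hlen.symm hl hI', ← hl]
      exact hx
  have hcard : ((Finset.range t).biUnion q).card ≤ t := by
    have := Finset.card_biUnion_le_card_mul (Finset.range t) q 1 fun s _ => hqcard s
    simpa using this
  refine (card_foundPairs_le_of_subset σ (Or.inl rfl) (fun y => ?_)).trans hcard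
  intro x hx
  obtain ⟨s, hs, hxs⟩ := Finset.mem_biUnion.1 hx
  rw [Finset.mem_range] at hs
  have hlen := Strategy.length_transcript_le σ (baseSet n B f y) t
  have hxq := hsub _ hxs
  rw [List.length_take, min_eq_left hs.le] at hxq
  exact Finset.mem_biUnion.2 ⟨s, Finset.mem_range.2 (by omega), hxq⟩

/-- The histories that may occur after `t` steps. -/
def reachable (σ : Strategy n) : ℕ → Finset (List Bool)
  | 0 => {[]}
  | t + 1 => (reachable σ t).biUnion fun h =>
      (σ h).elim (fun _ => {h ++ [true], h ++ [false]}) fun _ => {h}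

theorem card_reachable_le (σ : Strategy n) (t : ℕ) : (reachable σ t).card ≤ 2 ^ t := by
  induction t with
  | zero => simp [reachable]
  | succ t ih =>
    rw [reachable, pow_succ]
    refine (Finset.card_biUnion_le_card_mul _ _ 2 fun h _ => ?_).trans
      (Nat.mul_le_mul_right 2 ih)
    cases σ h with
    | inl I => exact Finset.card_le_two
    | inr r => simp

theorem transcript_mem_reachable (σ : Strategy n) (S : Finset (Fin n)) (t : ℕ) :
    σ.transcript S t ∈ reachable σ t := by
  induction t with
  | zero => simp [reachable, Strategy.transcript]
  | succ t ih =>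
    rw [reachable, Finset.mem_biUnion]
    refine ⟨_, ih, ?_⟩
    cases h : σ (σ.transcript S t) with
    | inl I => rw [Strategy.transcript_succ_inl h]; cases I.answer S <;> simp
    | inr r => rw [Strategy.transcript_succ_inr h]; simp

theorem length_le_of_mem_reachable (σ : Strategy n) {t : ℕ} {h : List Bool}
    (hh : h ∈ reachable σ t) : h.length ≤ t := by
  induction t generalizing h with
  | zero => simp_all [reachable]
  | succ t ih =>
    rw [reachable, Finset.mem_biUnion] at hh
    obtain ⟨l, hl, hh⟩ := hh
    have := ih hl
    cases h' : σ l with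
    | inl I =>
      simp only [h', Sum.elim_inl, Finset.mem_insert, Finset.mem_singleton] at hh
      rcases hh with rfl | rfl <;> simpa using this
    | inr r =>
      simp only [h', Sum.elim_inr, Finset.mem_singleton] at hh
      subst hh
      omega

/-- For a fixed set `G` of guesses, the number of blocks whose base cell is guessed has a small
exponential moment, since the blocks are independent. -/
theorem sum_pow_card_guessed_le (hm : 0 < m) (G : Finset ℕ) :
    ∑ y : Fin k → Fin m,
      (m : ℝ) ^ (Finset.univ.filter fun i => cellIndex i (y i) ∈ G).card ≤
    (m : ℝ) ^ k * Real.exp G.card := by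
  set g : Fin k → ℕ := fun i => (Finset.univ.filter fun j : Fin m => cellIndex i j ∈ G).card
    with hg
  have hm' : (0 : ℝ) < m := by exact_mod_cast hm
  have hgsum : ∑ i, g i ≤ G.card := by
    rw [hg, ← Finset.card_sigma]
    refine Finset.card_le_card_of_injOn (fun z => cellIndex z.1 z.2) ?_ ?_
    · rintro ⟨i, j⟩ hz
      simpa using hz
    · rintro ⟨i, j⟩ - ⟨i', j'⟩ - h
      obtain ⟨h1, h2⟩ := cellIndex_injective h
      simp only at h1 h2
      rw [h1, h2]
  have h1 : ∀ y : Fin k → Fin m,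
      (m : ℝ) ^ (Finset.univ.filter fun i => cellIndex i (y i) ∈ G).card =
        ∏ i, if cellIndex i (y i) ∈ G then (m : ℝ) else 1 := fun y => by
    rw [Finset.prod_ite]
    simp
  simp only [h1]
  rw [← Fintype.piFinset_univ, ← Finset.prod_univ_sum (fun _ => Finset.univ)
    fun (i : Fin k) (j : Fin m) => if cellIndex i j ∈ G then (m : ℝ) else 1]
  have h2 : ∀ i : Fin k, ∑ j : Fin m, (if cellIndex i j ∈ G then (m : ℝ) else 1) ≤
      m * Real.exp (g i) := by
    intro i
    calc ∑ j : Fin m, (if cellIndex i j ∈ G then (m : ℝ) else 1)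
        ≤ ∑ j : Fin m, ((if cellIndex i j ∈ G then (m : ℝ) else 0) + 1) := by
          refine Finset.sum_le_sum fun j _ => ?_
          split_ifs <;> linarith
      _ = m * (g i + 1) := by
          rw [Finset.sum_add_distrib, ← Finset.sum_filter, Finset.sum_const, Finset.sum_const]
          simp only [hg, nsmul_eq_mul, Finset.card_univ, Fintype.card_fin]
          ring
      _ ≤ m * Real.exp (g i) := by
          gcongr
          exact Real.add_one_le_exp _
  calc ∏ i : Fin k, ∑ j : Fin m, (if cellIndex i j ∈ G then (m : ℝ) else 1)
      ≤ ∏ i : Fin k, (m * Real.exp (g i)) := by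
        refine Finset.prod_le_prod (fun i _ => Finset.sum_nonneg fun j _ => ?_) fun i _ => h2 i
        split_ifs <;> positivity
    _ = (m : ℝ) ^ k * Real.exp (∑ i, g i : ℕ) := by
        rw [Finset.prod_mul_distrib, Finset.prod_const, ← Real.exp_sum]
        simp
    _ ≤ (m : ℝ) ^ k * Real.exp G.card := by gcongr

/-- A binary decision tree of depth `t` finds at most `2 * t / log m` base cells on average: it has
at most `2 ^ t` histories, each of which amounts to `t` guesses. -/
theorem card_foundPairs_mul_log_le (σ : Strategy n) (B f t : ℕ) (hm : 0 < m) :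
    ((foundPairs (k := k) (m := m) σ B f t).card : ℝ) * Real.log m ≤ 2 * t * (m : ℝ) ^ k := by
  have hm' : (0 : ℝ) < m := by exact_mod_cast hm
  set F : (Fin k → Fin m) → List Bool → ℕ := fun y h =>
    (Finset.univ.filter fun i => cellIndex i (y i) ∈ queriedCells σ B h).card with hF
  set tr : (Fin k → Fin m) → List Bool := fun y => σ.transcript (baseSet n B f y) t with htr
  have hcard : (foundPairs (k := k) (m := m) σ B f t).card = ∑ y, F y (tr y) := by
    rw [foundPairs, Finset.card_filter, Fintype.sum_prod_type]
    refine Finset.sum_congr rfl fun y _ => ?_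
    exact (Finset.card_filter _ _).symm
  have hmoment : ∑ y, (m : ℝ) ^ F y (tr y) ≤ (m : ℝ) ^ k * Real.exp (2 * t) := by
    calc ∑ y, (m : ℝ) ^ F y (tr y) ≤ ∑ y, ∑ h ∈ reachable σ t, (m : ℝ) ^ F y h :=
          Finset.sum_le_sum fun y _ => Finset.single_le_sum (f := fun h => (m : ℝ) ^ F y h)
            (fun h _ => by positivity) (transcript_mem_reachable σ _ t)
      _ = ∑ h ∈ reachable σ t, ∑ y, (m : ℝ) ^ F y h := Finset.sum_comm
      _ ≤ ∑ _h ∈ reachable σ t, (m : ℝ) ^ k * Real.exp t := by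
          refine Finset.sum_le_sum fun h hh => (sum_pow_card_guessed_le hm _).trans ?_
          gcongr
          exact (card_queriedCells_le σ B h).trans (length_le_of_mem_reachable σ hh)
      _ = (reachable σ t).card * ((m : ℝ) ^ k * Real.exp t) := by
          rw [Finset.sum_const, nsmul_eq_mul]
      _ ≤ Real.exp t * ((m : ℝ) ^ k * Real.exp t) := by
          gcongr
          calc ((reachable σ t).card : ℝ) ≤ (2 : ℝ) ^ t := by
                exact_mod_cast card_reachable_le σ t
            _ ≤ Real.exp 1 ^ t := by
                gcongr
                linarith [Real.exp_one_gt_d9]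
            _ = Real.exp t := by rw [← Real.exp_nat_mul, mul_one]
      _ = (m : ℝ) ^ k * Real.exp (2 * t) := by
          rw [two_mul, Real.exp_add]
          ring
  -- the tangent of the exponential function at `2 * t` replaces Jensen's inequality
  have htangent : ∀ y, Real.exp (2 * t) * (F y (tr y) * Real.log m - 2 * t + 1) ≤
      (m : ℝ) ^ F y (tr y) := by
    intro y
    have h1 : (m : ℝ) ^ F y (tr y) =
        Real.exp (2 * t) * Real.exp (F y (tr y) * Real.log m - 2 * t) := by
      rw [← Real.exp_add, add_sub_cancel, Real.exp_nat_mul, Real.exp_log hm']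
    rw [h1]
    gcongr
    exact Real.add_one_le_exp _
  have h2 : Real.exp (2 * t) * ∑ y, (F y (tr y) * Real.log m - 2 * t + 1) ≤
      Real.exp (2 * t) * (m : ℝ) ^ k := by
    rw [Finset.mul_sum, mul_comm _ ((m : ℝ) ^ k)]
    exact (Finset.sum_le_sum fun y _ => htangent y).trans hmoment
  have h3 := le_of_mul_le_mul_left h2 (Real.exp_pos _)
  simp only [Finset.sum_add_distrib, Finset.sum_sub_distrib, ← Finset.sum_mul, Finset.sum_const,
    Finset.card_univ, Fintype.card_pi, Finset.prod_const, Fintype.card_fin, nsmul_eq_mul,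
    Nat.cast_pow] at h3
  rw [hcard]
  push_cast
  linarith

end HardSets

/-! ### The lower bounds -/

namespace RandomizedAlgorithm

variable {n : ℕ} (A : RandomizedAlgorithm n)

theorem Pr_ofReal_le_queries_mono {S : Finset (Fin n)} {x p : ℝ} {y : ℝ≥0∞}
    (hxy : ENNReal.ofReal x ≤ y) (h : p ≤ A.Pr {ω | y ≤ A.queries S ω}) :
    p ≤ A.Pr {ω | ENNReal.ofReal x ≤ A.queries S ω} := by
  let _ := A.measurableSpace
  let _ := A.isProbabilityMeasure
  exact h.trans (measureReal_mono fun ω (hω : y ≤ _) => hxy.trans hω)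

theorem ofReal_le_floor_add_one (x : ℝ) : ENNReal.ofReal x ≤ ((⌊x⌋₊ + 1 : ℕ) : ℝ≥0∞) := by
  rw [← ENNReal.ofReal_natCast]
  refine ENNReal.ofReal_le_ofReal ?_
  push_cast
  exact (Nat.lt_floor_add_one x).le

end RandomizedAlgorithm

/-- Two sizes `a ≤ b` that an algorithm has to tell apart, up to a factor of `R` from each other,
force it to ask at least `c * g n w` queries, with probability at least `1 / 4`, on some set of any
given size `w` in between. -/
def SeparationBound (Q : ∀ n : ℕ, RandomizedAlgorithm n → Prop) (g : ℕ → ℕ → ℝ) (R : ℕ) (c : ℝ) :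
    Prop :=
  ∀ (n a w b : ℕ) (ε : ℝ) (K : Set ℕ), 1 ≤ a → a ≤ w → w ≤ b → b ≤ n → b ≤ R * a →
    (∀ r, ¬ (IsEstimate ε a r ∧ IsEstimate ε b r)) → a ∈ K → b ∈ K →
    ∀ A : RandomizedAlgorithm n, Q n A → A.ApproximatesOn ε K →
      ∃ S : Finset (Fin n), S.card = w ∧
        1 / 4 ≤ A.Pr {ω | ENNReal.ofReal (c * g n w) ≤ A.queries S ω}

/-- It suffices to treat the case that `c * g n w` is at least `1`, since one query is always
needed to separate two sizes. -/
theorem separationBound_of_one_le_floor {Q : ∀ n : ℕ, RandomizedAlgorithm n → Prop}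
    {g : ℕ → ℕ → ℝ} {R : ℕ} {c : ℝ}
    (h : ∀ (n a w b t : ℕ) (ε : ℝ) (K : Set ℕ), 1 ≤ a → a ≤ w → w ≤ b → b ≤ n → b ≤ R * a →
      (∀ r, ¬ (IsEstimate ε a r ∧ IsEstimate ε b r)) → a ∈ K → b ∈ K →
      ∀ A : RandomizedAlgorithm n, Q n A → A.ApproximatesOn ε K →
        1 ≤ t → (t : ℝ) ≤ c * g n w →
        ∃ S : Finset (Fin n), S.card = w ∧
          1 / 4 ≤ A.Pr {ω | ((t + 1 : ℕ) : ℝ≥0∞) ≤ A.queries S ω}) :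
    SeparationBound Q g R c := by
  intro n a w b ε K ha haw hwb hbn hbR hab haK hbK A hQ hA
  have key : ∃ S : Finset (Fin n), S.card = w ∧
      1 / 4 ≤ A.Pr {ω | ((⌊c * g n w⌋₊ + 1 : ℕ) : ℝ≥0∞) ≤ A.queries S ω} := by
    rcases Nat.eq_zero_or_pos ⌊c * g n w⌋₊ with h0 | h0
    · rw [h0]
      have hex : ∀ s ≤ n, ∃ S : Finset (Fin n), S.card = s := fun s hs => by
        obtain ⟨S, -, hS⟩ := Finset.exists_subset_card_eq
          (s := (Finset.univ : Finset (Fin n))) (n := s) (by simpa using hs)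
        exact ⟨S, hS⟩
      obtain ⟨Sa, hSa⟩ := hex a (by omega)
      obtain ⟨Sb, hSb⟩ := hex b hbn
      obtain ⟨S, hS⟩ := hex w (by omega)
      exact ⟨S, hS, A.quarter_le_Pr_one_le_queries (Sa := Sa) (Sb := Sb) (by rwa [hSa, hSb])
        (by rwa [hSa]) (by rwa [hSb]) hA S⟩
    · refine h n a w b _ ε K ha haw hwb hbn hbR hab haK hbK A hQ hA h0 (Nat.floor_le ?_)
      exact (Nat.pos_of_floor_pos h0).le
  obtain ⟨S, hS, hP⟩ := key
  exact ⟨S, hS, A.Pr_ofReal_le_queries_mono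
    (RandomizedAlgorithm.ofReal_le_floor_add_one _) hP⟩

/-- If the claimed bound is not trivial, the universe has room for `12 * t` cells of length `b`; one
more window of this length is left for the fixed elements. -/
theorem twelve_mul_le_div_sub_one {n a w b t R : ℕ} (ha : 1 ≤ a) (haw : a ≤ w) (hwb : w ≤ b)
    (hbR : b ≤ R * a) (ht : 1 ≤ t) (htn : (t : ℝ) ≤ 1 / (48 * (R : ℝ) ^ 3) * (n / w)) :
    12 * (t : ℝ) ≤ ((n / b - 1 : ℕ) : ℝ) ∧ 2 ≤ n / b := by
  have hR : 1 ≤ R := by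
    rcases Nat.eq_zero_or_pos R with rfl | h
    · omega
    · exact h
  have hR' : (1 : ℝ) ≤ R := by exact_mod_cast hR
  have ha' : (1 : ℝ) ≤ a := by exact_mod_cast ha
  have haw' : (a : ℝ) ≤ w := by exact_mod_cast haw
  have hbR' : (b : ℝ) ≤ R * a := by exact_mod_cast hbR
  have hwb' : (w : ℝ) ≤ b := by exact_mod_cast hwb
  have hw0 : (0 : ℝ) < w := by linarith
  have hb0 : (0 : ℝ) < b := by linarith
  have ht' : (1 : ℝ) ≤ t := by exact_mod_cast ht
  have h1 : 48 * (t : ℝ) ≤ n / b := by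
    have e1 : (1 : ℝ) / (48 * (R : ℝ) ^ 3) * (n / w) ≤ 1 / 48 * (n / b) := by
      rw [div_mul_div_comm, div_mul_div_comm, div_le_div_iff₀ (by positivity) (by positivity)]
      have e2 : (b : ℝ) ≤ R ^ 3 * w := by
        calc (b : ℝ) ≤ R * a := hbR'
          _ ≤ R * w := by gcongr
          _ ≤ R ^ 3 * w := by
            gcongr
            exact le_self_pow₀ hR' (by norm_num)
      have e3 := mul_le_mul_of_nonneg_left e2 (Nat.cast_nonneg (α := ℝ) n)
      nlinarith
    linarith
  have h2 : (n : ℝ) / b < ((n / b : ℕ) : ℝ) + 1 := by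
    rw [div_lt_iff₀ hb0, mul_comm]
    exact_mod_cast Nat.lt_mul_div_succ n (show 0 < b by omega)
  have h3 : 2 ≤ n / b := by
    have : (1 : ℝ) < ((n / b : ℕ) : ℝ) := by linarith
    exact_mod_cast this
  refine ⟨?_, h3⟩
  rw [Nat.cast_sub (by omega)]
  push_cast
  linarith

theorem mul_sub_one_add_le {n a b : ℕ} (hab : a ≤ b) (h : 2 ≤ n / b) :
    (n / b - 1) * b + a ≤ n := by
  have h1 : n / b * b ≤ n := Nat.div_mul_le_self n b
  have h2 : (n / b - 1) * b + b = n / b * b := by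
    rw [Nat.sub_mul, one_mul]
    have : 1 * b ≤ n / b * b := Nat.mul_le_mul_right b (by omega)
    omega
  omega

theorem separationBound_nonAdaptive (R : ℕ) :
    SeparationBound (fun _ A => A.NonAdaptive) (fun n w => (n : ℝ) / w) R
      (1 / (48 * (R : ℝ) ^ 3)) := by
  refine separationBound_of_one_le_floor
    fun n a w b t ε K ha haw hwb hbn hbR hab haK hbK A hQ hA ht htn => ?_
  obtain ⟨h1, h2⟩ := twelve_mul_le_div_sub_one ha haw hwb hbR ht htn
  have h3 := mul_sub_one_add_le (haw.trans hwb) h2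
  refine A.exists_card_eq_and_quarter_le_Pr (k := 1) (m := n / b - 1) (B := b) (f := a - 1)
    hab haK hbK hA haw hwb (by omega) one_pos (by omega) (by omega)
    (by rw [one_mul]; omega) fun ω => ?_
  have h4 : ((foundPairs (k := 1) (m := n / b - 1) (A.strategy ω) b (a - 1) t).card : ℝ) ≤ t := by
    exact_mod_cast card_foundPairs_le_of_nonAdaptive (hQ ω) b (a - 1) t
  rw [pow_one, Nat.cast_one]
  linarith

theorem one_lt_div_sq {n w : ℕ} (hw : 1 ≤ w) (h : w ^ 2 < n) : 1 < (n : ℝ) / (w : ℝ) ^ 2 := by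
  rw [one_lt_div (by positivity)]
  exact_mod_cast h

theorem adaptiveBound_le {n w : ℕ} : adaptiveBound n w ≤ (n : ℝ) / w := by
  unfold adaptiveBound
  split_ifs
  · exact le_rfl
  · exact min_le_right _ _

theorem adaptiveBound_nonneg {n w : ℕ} (hw : 1 ≤ w) : 0 ≤ adaptiveBound n w := by
  unfold adaptiveBound
  split_ifs with h
  · positivity
  · exact le_min (mul_nonneg (by positivity) (Real.log_nonneg (one_lt_div_sq hw (by omega)).le))
      (by positivity)

/-- For `n` at most of the order of `w ^ 2`, the blocks are single cells; for larger `n`, there are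
about `w` blocks of about `n / w ^ 2` cells, each of which takes a binary search. -/
theorem separationBound_adaptive (R : ℕ) :
    SeparationBound (fun _ _ => True) adaptiveBound R (1 / (48 * (R : ℝ) ^ 3)) := by
  refine separationBound_of_one_le_floor
    fun n a w b t ε K ha haw hwb hbn hbR hab haK hbK A _ hA ht htn => ?_
  have hR : 1 ≤ R := by
    rcases Nat.eq_zero_or_pos R with rfl | h
    · omega
    · exact h
  have hR' : (1 : ℝ) ≤ R := by exact_mod_cast hR
  have ha' : (1 : ℝ) ≤ a := by exact_mod_cast ha
  have haw' : (a : ℝ) ≤ w := by exact_mod_cast haw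
  have hbR' : (b : ℝ) ≤ R * a := by exact_mod_cast hbR
  have hwb' : (w : ℝ) ≤ b := by exact_mod_cast hwb
  have hw0 : (0 : ℝ) < w := by linarith
  have hc0 : (0 : ℝ) < 1 / (48 * (R : ℝ) ^ 3) := by positivity
  have hwRa : (w : ℝ) ≤ R * a := hwb'.trans hbR'
  have htn' : (t : ℝ) ≤ 1 / (48 * (R : ℝ) ^ 3) * (n / w) :=
    htn.trans (mul_le_mul_of_nonneg_left adaptiveBound_le hc0.le)
  rcases le_or_gt n (4 * R ^ 2 * w ^ 2) with hnw | hnw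
  · obtain ⟨h1, h2⟩ := twelve_mul_le_div_sub_one ha haw hwb hbR ht htn'
    have h3 := mul_sub_one_add_le (haw.trans hwb) h2
    -- at most `a` blocks, as each of them contains a base element
    set k := min a (n / b - 1) with hk
    have hka : k ≤ a := min_le_left _ _
    have hkn : k ≤ n / b - 1 := min_le_right _ _
    have hkb : k * b ≤ (n / b - 1) * b := Nat.mul_le_mul_right b hkn
    have hta : 12 * (t : ℝ) ≤ a := by
      have hnw' : (n : ℝ) ≤ 4 * R ^ 2 * w ^ 2 := by exact_mod_cast hnw
      have e1 : (n : ℝ) / w ≤ 4 * R ^ 2 * (R * a) := by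
        rw [div_le_iff₀ hw0]
        calc (n : ℝ) ≤ 4 * R ^ 2 * w ^ 2 := hnw'
          _ = 4 * R ^ 2 * w * w := by ring
          _ ≤ 4 * R ^ 2 * (R * a) * w := by gcongr
      have e2 : 1 / (48 * (R : ℝ) ^ 3) * (n / w) ≤
          1 / (48 * (R : ℝ) ^ 3) * (4 * R ^ 2 * (R * a)) := by gcongr
      have e3 : 1 / (48 * (R : ℝ) ^ 3) * (4 * R ^ 2 * (R * a)) = a / 12 := by
        field_simp
        norm_num
      linarith
    have htk : 12 * (t : ℝ) ≤ k := by
      rw [hk, Nat.cast_min]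
      exact le_min hta h1
    refine A.exists_card_eq_and_quarter_le_Pr (k := k) (m := 1) (B := b) (f := a - k)
      hab haK hbK hA haw hwb (by omega) (by omega) one_pos (by omega)
      (by rw [mul_one]; omega) fun ω => ?_
    have h4 : ((foundPairs (k := k) (m := 1) (A.strategy ω) b (a - k) t).card : ℝ) ≤ t := by
      exact_mod_cast card_foundPairs_one_le (A.strategy ω) b (a - k) t
    rw [Nat.cast_one, one_pow]
    linarith
  · have hnw' : 4 * (R : ℝ) ^ 2 * w ^ 2 < n := by exact_mod_cast hnw
    set M := (n : ℝ) / (w : ℝ) ^ 2 with hM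
    have hM4 : 4 * (R : ℝ) ^ 2 < M := by
      rw [hM, lt_div_iff₀ (by positivity)]
      exact hnw'
    have hMpos : 0 < M := by nlinarith
    set m := n / (a * b) with hm
    -- with `M ≥ 4 * R ^ 2` the rounding and the factor `R` cost at most half of `log M`
    have hmM : M / (2 * R) ≤ m := by
      have hab0 : 0 < a * b := Nat.mul_pos (by omega) (by omega)
      have hab0' : (0 : ℝ) < (a * b : ℕ) := by exact_mod_cast hab0
      have e1 : (n : ℝ) / (a * b : ℕ) < (m : ℝ) + 1 := by
        rw [div_lt_iff₀ hab0', mul_comm]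
        exact_mod_cast Nat.lt_mul_div_succ n hab0
      have e2 : M / R ≤ n / (a * b : ℕ) := by
        rw [Nat.cast_mul] at hab0'
        rw [hM, div_div, Nat.cast_mul]
        have : (a : ℝ) * b ≤ w ^ 2 * R := by
          calc (a : ℝ) * b ≤ w * (R * a) := by gcongr
            _ ≤ w * (R * w) := by gcongr
            _ = w ^ 2 * R := by ring
        gcongr
      have e3 : 4 * (R : ℝ) ≤ M / R := by
        rw [le_div_iff₀ (by positivity)]
        nlinarith
      have e4 : M / (2 * R) = M / R / 2 := by rw [mul_comm 2 (R : ℝ), div_mul_eq_div_div]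
      rw [e4]
      linarith
    have hm0' : (0 : ℝ) < m := lt_of_lt_of_le (by positivity) hmM
    have hm0 : 0 < m := by exact_mod_cast hm0'
    have hlog : Real.log M ≤ 2 * Real.log m := by
      have e1 : M ≤ (m : ℝ) ^ 2 := by
        calc M ≤ (M / (2 * R)) ^ 2 := by
              rw [div_pow, le_div_iff₀ (by positivity)]
              nlinarith
          _ ≤ (m : ℝ) ^ 2 := by gcongr
      have := Real.log_le_log hMpos e1
      rwa [Real.log_pow] at this
    have hlogM : 0 < Real.log M := Real.log_pos (by nlinarith)
    have hlogm : 0 < Real.log m := by linarith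
    have hg : adaptiveBound n w ≤ w * Real.log M := by
      have hlt : ¬ n ≤ w ^ 2 := by
        have : w ^ 2 ≤ 4 * R ^ 2 * w ^ 2 :=
          Nat.le_mul_of_pos_left _ (by positivity)
        omega
      rw [adaptiveBound, if_neg hlt]
      exact min_le_left _ _
    have htk : 24 * (t : ℝ) ≤ a * Real.log m := by
      calc 24 * (t : ℝ) ≤ 24 * (1 / (48 * (R : ℝ) ^ 3) * (w * Real.log M)) := by
            gcongr
            exact htn.trans (mul_le_mul_of_nonneg_left hg hc0.le)
        _ ≤ 24 * (1 / (48 * (R : ℝ) ^ 1) * (R * a * (2 * Real.log m))) := by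
            gcongr
            norm_num
        _ = a * Real.log m := by
            field_simp
            norm_num
    refine A.exists_card_eq_and_quarter_le_Pr (k := a) (m := m) (B := b) (f := 0)
      hab haK hbK hA haw hwb (by omega) (by omega) hm0 (by omega) ?_ fun ω => ?_
    · calc a * m * b + 0 = n / (a * b) * (a * b) := by rw [hm]; ring
        _ ≤ n := Nat.div_mul_le_self _ _
    · have h4 := card_foundPairs_mul_log_le (k := a) (m := m) (A.strategy ω) b 0 t hm0
      rw [← mul_le_mul_iff_left₀ hlogm]
      refine h4.trans ?_
      have h5 : (0 : ℝ) < (m : ℝ) ^ a := by positivity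
      nlinarith

/-- The lower bounds, without and with advice, follow from the separation of two sizes: these are
`w` and `5 * w` in the first case (or `0` and `n` if the universe is too small for this), the
smallest and the largest admissible size in the second. -/
theorem queryLowerBound_of_separationBound {Q : ∀ n : ℕ, RandomizedAlgorithm n → Prop}
    {g : ℕ → ℕ → ℝ} (hg0 : ∀ n w, 1 ≤ w → 0 ≤ g n w) (hg : ∀ n w, g n w ≤ (n : ℝ) / w)
    (h : ∀ R : ℕ, SeparationBound Q g R (1 / (48 * (R : ℝ) ^ 3))) :
    QueryLowerBound Q g (1 / 4) := by
  constructor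
  · intro ε hε hε1
    refine ⟨1 / (48 * ((5 : ℕ) : ℝ) ^ 3), by norm_num, fun n w hw hwn A hQ hA => ?_⟩
    have hw' : (1 : ℝ) ≤ w := by exact_mod_cast hw
    rcases le_or_gt (5 * w) n with h5 | h5
    · refine h 5 n w w (5 * w) ε Set.univ hw le_rfl (by omega) h5 le_rfl ?_ (Set.mem_univ _)
        (Set.mem_univ _) A hQ hA
      rintro r ⟨⟨-, h1⟩, h2, -⟩
      rw [div_mul_eq_mul_div, one_mul, div_le_iff₀ (by linarith)] at h2
      push_cast at h2
      have h3 : r * (1 + ε) ≤ (1 + ε) * w * (1 + ε) := by gcongr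
      have h4 : (1 + ε) * (1 + ε) ≤ 4 := by nlinarith
      have h5 : (1 + ε) * (1 + ε) * w ≤ 4 * w := by gcongr
      linarith
    · obtain ⟨S, -, hS⟩ := Finset.exists_subset_card_eq
        (s := (Finset.univ : Finset (Fin n))) (n := w) (by simpa using hwn)
      refine ⟨S, hS, A.Pr_ofReal_le_queries_mono (y := ((0 + 1 : ℕ) : ℝ≥0∞)) ?_
        (A.quarter_le_Pr_one_le_queries (Sa := ∅) (Sb := Finset.univ) ?_ (Set.mem_univ _)
          (Set.mem_univ _) hA S)⟩
      · rw [← ENNReal.ofReal_natCast]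
        refine ENNReal.ofReal_le_ofReal ?_
        have h6 : g n w ≤ 5 := by
          refine (hg n w).trans ?_
          rw [div_le_iff₀ (by linarith)]
          exact_mod_cast h5.le
        have := hg0 n w hw
        push_cast
        nlinarith
      · rintro r ⟨⟨-, h1⟩, h2, -⟩
        have hn : (0 : ℝ) < n := by
          have : 0 < n := by omega
          exact_mod_cast this
        simp only [Finset.card_empty, Nat.cast_zero, mul_zero, Finset.card_univ,
          Fintype.card_fin] at h1 h2
        have : 0 < 1 / (1 + ε) * (n : ℝ) := by positivity
        linarith
  · intro ε hε hε1 κ hκ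
    have hR : κ ^ 2 ≤ (⌈κ ^ 2⌉₊ : ℝ) := Nat.le_ceil _
    have hR0 : (0 : ℝ) < (⌈κ ^ 2⌉₊ : ℝ) := lt_of_lt_of_le (by positivity) hR
    refine ⟨1 / (48 * (⌈κ ^ 2⌉₊ : ℝ) ^ 3), by positivity, fun n w v hv hwn hw hadv A hQ hA => ?_⟩
    classical
    set P := (Finset.range (n + 1)).filter (· ∈ admissibleSizes κ v) with hP
    have hmem : ∀ s, s ∈ P ↔ s ≤ n ∧ s ∈ admissibleSizes κ v := fun s => by
      rw [hP, Finset.mem_filter, Finset.mem_range, Nat.lt_succ_iff]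
    have hwP : w ∈ P := (hmem w).2 ⟨hwn, hw⟩
    have hne : P.Nonempty := ⟨w, hwP⟩
    obtain ⟨han, haK⟩ := (hmem _).1 (P.min'_mem hne)
    obtain ⟨hbn, hbK⟩ := (hmem _).1 (P.max'_mem hne)
    have hmin : ∀ s ∈ P, P.min' hne ≤ s := fun s hs => P.min'_le s hs
    have hmax : ∀ s ∈ P, s ≤ P.max' hne := fun s hs => P.le_max' s hs
    generalize P.min' hne = a at han haK hmin
    generalize P.max' hne = b at hbn hbK hmax
    have hκ0 : 0 < κ := by linarith
    have ha : 1 ≤ a := by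
      have : (0 : ℝ) < a := lt_of_lt_of_le (by positivity) haK.1
      exact_mod_cast this
    refine h ⌈κ ^ 2⌉₊ n a w b ε (admissibleSizes κ v) ha (hmin w hwP) (hmax w hwP) hbn ?_ ?_
      haK hbK A hQ hA
    · have h1 : (b : ℝ) ≤ (⌈κ ^ 2⌉₊ : ℝ) * a := by
        have h2 : v ≤ κ * a := by
          have := haK.1
          rwa [div_le_iff₀ hκ0, mul_comm] at this
        calc (b : ℝ) ≤ κ * v := hbK.2
          _ ≤ κ * (κ * a) := by gcongr
          _ = κ ^ 2 * a := by ring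
          _ ≤ _ := by gcongr
      exact_mod_cast h1
    · rintro r ⟨⟨-, hra⟩, hrb, -⟩
      refine hadv ⟨r, fun s hs hsn => ?_⟩
      have hsP := (hmem s).2 ⟨hsn, hs⟩
      have h1 : (a : ℝ) ≤ s := by exact_mod_cast hmin s hsP
      have h2 : (s : ℝ) ≤ b := by exact_mod_cast hmax s hsP
      constructor
      · refine le_trans ?_ hrb
        gcongr
      · refine hra.trans ?_
        gcongr

theorem mainTheorem2 :
    -- non-adaptive upper bound
    (∃ A : (n : ℕ) → (ε : ℝ) → RandomizedAlgorithm n,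
      (∀ (n : ℕ) (ε : ℝ), 0 < ε → ε ≤ 1 →
        (A n ε).NonAdaptive ∧ (A n ε).IsSetSizeApproximation ε) ∧
      QueriesBoundedWithExponentialTail A) ∧
    -- non-adaptive lower bound
    (∃ p : ℝ, 0 < p ∧
      QueryLowerBound (fun _ A => A.NonAdaptive) (fun n w => (n : ℝ) / w) p) ∧
    -- adaptive upper bound
    (∃ A : (n : ℕ) → (ε : ℝ) → RandomizedAlgorithm n,
      (∀ (n : ℕ) (ε : ℝ), 0 < ε → ε ≤ 1 → (A n ε).IsSetSizeApproximation ε) ∧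
      (∃ C : ℝ, 0 < C ∧ ∀ (n : ℕ) (ε : ℝ), 2 ≤ n → 0 < ε → ε ≤ 1 →
        ∀ (S : Finset (Fin n)) (ω : (A n ε).Coins),
          (A n ε).queries S ω ≤ ENNReal.ofReal (C * (max (S.card : ℝ) 1 * Real.log n))) ∧
      QueriesBoundedWithExponentialTail A) ∧
    -- adaptive lower bound
    (∃ p : ℝ, 0 < p ∧
      QueryLowerBound (fun _ _ => True) adaptiveBound p) := by
  refine ⟨⟨raceAlgorithm fun n => QueryTree.scan (List.finRange n) 0, fun n ε hε hε1 =>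
      ⟨nonAdaptive_raceAlgorithm_scan n ε, ?_⟩, queriesBounded_raceAlgorithm _⟩,
    ⟨1 / 4, by norm_num, ?_⟩,
    ⟨raceAlgorithm QueryTree.searchAll, fun n ε hε hε1 => ?_,
      queries_raceAlgorithm_searchAll_le, queriesBounded_raceAlgorithm _⟩,
    ⟨1 / 4, by norm_num, ?_⟩⟩
  · exact isSetSizeApproximation_raceAlgorithm
      (fun _ S => QueryTree.value_scan_finRange S) n hε hε1
  · exact queryLowerBound_of_separationBound (fun n w _ => by positivity) (fun _ _ => le_rfl)
      separationBound_nonAdaptive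
  · exact isSetSizeApproximation_raceAlgorithm
      (fun _ S => QueryTree.value_searchAll S) n hε hε1
  · exact queryLowerBound_of_separationBound (fun n w hw => adaptiveBound_nonneg hw)
      (fun _ _ => adaptiveBound_le) separationBound_adaptive
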